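/- Consider the triangular lattice of unit side length with one family of lattice lines vertical. For nonnegative integers $a,b,c$ let $H_{a,b,c}$ be the lattice hexagon with sides of lengths $a,b,c,a,b,c$ clockwise from its (vertical) left side. Measure heights by an upward-pointing $i$-axis whose unit is half the side length of a unit triangle, placed so that the line $i=k$ is the perpendicular bisector of the left side of $H_{a,b,c}$, where $k$ is a fixed integer. A lozenge is the union of two unit triangles sharing an edge; a lozenge tiling of $H_{a,b,c}$ is a set of lozenges contained in $H_{a,b,c}$ that covers it without gaps or overlaps. Let $K$ be a field with $2\neq 0$ and let $q,X,Y\in K$ with $q\ne 0$ and $q^2\neq 1$ (for instance, $q,X,Y$ may be indeterminates and $K=\mathbb{Q}(q,X,Y)$). A lozenge whose long diagonal is horizontal and whose center has $i$-coordinate $n$ gets weight $\frac{Xq^{n}+Yq^{-n}}{2}$, every other lozenge gets weight $1$, and the weight of a tiling is the product of the weights of its lozenges. Let $\operatorname{M}_{(q,X,Y,k)}(H_{a,b,c})$ be the sum of the weights of all lozenge tilings of $H_{a,b,c}$. Put $$\langle n\rangle_q=\frac{q^n-q^{-n}}{q-q^{-1}},\qquad \langle n\rangle_q!=\langle 1\rangle_q\langle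 2\rangle_q\cdots\langle n\rangle_q,\qquad H_q(n)=\prod_{i=0}^{n-1}\langle i\rangle_q!,$$ with empty products equal to $1$. If $H_q(a+b)H_q(b+c)H_q(c+a)\neq 0$ (which is automatic when $q$ is not a root of unity), then $$\operatorname{M}_{(q,X,Y,k)}(H_{a,b,c})=\Bigg[\prod_{i=1}^{b}\prod_{j=1}^{c}\frac{Xq^{k+i-j}+Yq^{-(k+i-j)}}{2}\Bigg]\cdot\frac{H_q(a)H_q(b)H_q(c)H_q(a+b+c)}{H_q(a+b)H_q(b+c)H_q(c+a)}.$$ -/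

import Mathlib

/-!  Lozenge tilings of hexagons on the triangular lattice.

The triangular lattice of unit side length is drawn so that one family of lattice lines is vertical.
After a lattice point is chosen as origin, the pair `(x, y) : ℤ × ℤ` denotes the lattice point that is
reached from it by `x` unit steps to the northeast and `y` unit steps to the north.  A unit
step to the southeast therefore adds `(1, -1)`.  -/

namespace LozengeTiling

/-- A unit triangle of the lattice.
* `right x y` is the right-pointing triangle: it has its vertical side, from `(x, y)` up to
  `(x, y + 1)`, on the left and its third vertex `(x + 1, y)` on the right.
* `left x y` is the left-pointing triangle: it has its vertical side, from `(x, y)` up to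
  `(x, y + 1)`, on the right and its third vertex `(x - 1, y + 1)` on the left. -/
inductive UnitTriangle where
  | right (x y : ℤ)
  | left (x y : ℤ)

/-- The three vertices of a unit triangle. -/
def UnitTriangle.vertices : UnitTriangle → Set (ℤ × ℤ)
  | .right x y => {(x, y), (x, y + 1), (x + 1, y)}
  | .left x y => {(x, y), (x, y + 1), (x - 1, y + 1)}

/-- A unit lozenge, i.e. the union of two unit triangles that share an edge, sorted by the direction of its long diagonal.  In each case `(x, y)` is an endpoint of the shared edge:
* `horizontal x y`: the shared edge goes from `(x, y)` north to `(x, y + 1)`, and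
  the long diagonal is horizontal, from `(x - 1, y + 1)` to `(x + 1, y)`;
* `negative x y`: the shared edge goes from `(x, y)` northeast to `(x + 1, y)`, and
  the long diagonal has negative slope, from `(x, y + 1)` to `(x + 1, y - 1)`;
* `positive x y`: the shared edge goes from `(x, y)` southeast to `(x + 1, y - 1)`, and
  the long diagonal has positive slope, from `(x, y - 1)` to `(x + 1, y)`. -/
inductive Lozenge where
  | horizontal (x y : ℤ)
  | negative (x y : ℤ)
  | positive (x y : ℤ)

/-- The two unit triangles that make up a lozenge. -/
def Lozenge.triangles : Lozenge → Set UnitTriangle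
  | .horizontal x y => {.right x y, .left x y}
  | .negative x y => {.right x y, .left (x + 1) (y - 1)}
  | .positive x y => {.right x (y - 1), .left (x + 1) (y - 1)}

/-- The lozenges above are exactly the pairs of distinct unit triangles that share an edge
(that is, have at least two common vertices). -/
theorem exists_lozenge_iff (S T : UnitTriangle) :
    (∃ l : Lozenge, l.triangles = {S, T}) ↔
      S ≠ T ∧ (S.vertices ∩ T.vertices).Nontrivial := by
  constructor
  · rintro ⟨l, hl⟩
    rcases l with ⟨x, y⟩ | ⟨x, y⟩ | ⟨x, y⟩
    · simp only [Lozenge.triangles, Set.pair_eq_pair_iff] at hl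
      rcases hl with ⟨rfl, rfl⟩ | ⟨rfl, rfl⟩ <;>
      exact ⟨by simp, (x, y), by simp [UnitTriangle.vertices], (x, y + 1),
        by simp [UnitTriangle.vertices], by simp⟩
    · simp only [Lozenge.triangles, Set.pair_eq_pair_iff] at hl
      rcases hl with ⟨rfl, rfl⟩ | ⟨rfl, rfl⟩ <;>
      exact ⟨by simp, (x, y), by simp [UnitTriangle.vertices], (x + 1, y),
        by simp [UnitTriangle.vertices], by simp⟩
    · simp only [Lozenge.triangles, Set.pair_eq_pair_iff] at hl
      rcases hl with ⟨rfl, rfl⟩ | ⟨rfl, rfl⟩ <;>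
      exact ⟨by simp, (x, y), by simp [UnitTriangle.vertices], (x + 1, y - 1),
        by simp [UnitTriangle.vertices], by simp⟩
  · have key : ∀ x y u v : ℤ,
        (UnitTriangle.vertices (.right x y) ∩ UnitTriangle.vertices (.left u v)).Nontrivial →
        ∃ l : Lozenge, l.triangles = {.right x y, .left u v} := by
      rintro x y u v ⟨⟨p, p'⟩, ⟨h1, h2⟩, ⟨r, r'⟩, ⟨h3, h4⟩, hne⟩
      simp only [UnitTriangle.vertices, Set.mem_insert_iff, Set.mem_singleton_iff,
        Prod.mk.injEq] at h1 h2 h3 h4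
      have hne' : p = r → p' ≠ r' := by
        rintro rfl rfl
        exact hne rfl
      have : (u = x ∧ v = y) ∨ (u = x + 1 ∧ v = y - 1) ∨ (u = x + 1 ∧ v = y) := by omega
      rcases this with ⟨rfl, rfl⟩ | ⟨rfl, rfl⟩ | ⟨rfl, rfl⟩
      · exact ⟨.horizontal u v, rfl⟩
      · exact ⟨.negative x y, rfl⟩
      · exact ⟨.positive x (v + 1), by simp [Lozenge.triangles]⟩
    rintro ⟨hST, hn⟩
    rcases S with ⟨x, y⟩ | ⟨x, y⟩ <;> rcases T with ⟨u, v⟩ | ⟨u, v⟩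
    · exfalso
      obtain ⟨⟨p, p'⟩, ⟨h1, h2⟩, ⟨r, r'⟩, ⟨h3, h4⟩, hne⟩ := hn
      simp only [UnitTriangle.vertices, Set.mem_insert_iff, Set.mem_singleton_iff,
        Prod.mk.injEq] at h1 h2 h3 h4
      have hne' : p = r → p' ≠ r' := by
        rintro rfl rfl
        exact hne rfl
      have : x = u → y ≠ v := by
        rintro rfl rfl
        exact hST rfl
      omega
    · exact key x y u v hn
    · rw [Set.pair_comm]
      exact key u v x y (by rwa [Set.inter_comm])
    · exfalso
      obtain ⟨⟨p, p'⟩, ⟨h1, h2⟩, ⟨r, r'⟩, ⟨h3, h4⟩, hne⟩ := hn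
      simp only [UnitTriangle.vertices, Set.mem_insert_iff, Set.mem_singleton_iff,
        Prod.mk.injEq] at h1 h2 h3 h4
      have hne' : p = r → p' ≠ r' := by
        rintro rfl rfl
        exact hne rfl
      have : x = u → y ≠ v := by
        rintro rfl rfl
        exact hST rfl
      omega

/-- The lattice points of the closed hexagon with sides of lengths `a, b, c, a, b, c` clockwise from
the left side.  The origin is the lower endpoint of the left side, so that the corners are, clockwise,
`(0, 0)`, `(0, a)`, `(b, a)`, `(b + c, a - c)`, `(b + c, -c)`, `(c, -c)`. -/
def hexagonPoints (a b c : ℕ) : Set (ℤ × ℤ) :=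
  {p | 0 ≤ p.1 ∧ p.1 ≤ b + c ∧ -(c : ℤ) ≤ p.2 ∧ p.2 ≤ a ∧ 0 ≤ p.1 + p.2 ∧ p.1 + p.2 ≤ a + b}

/-- The hexagonal region `H_{a,b,c}`, as the set of the unit triangles contained in it (the hexagon
is convex, so these are the unit triangles whose vertices lie in it). -/
def hexagon (a b c : ℕ) : Set UnitTriangle :=
  {T | T.vertices ⊆ hexagonPoints a b c}

/-- A lozenge tiling of a region `R`: a collection of lozenges contained in `R` such that
each unit triangle of `R` is covered by exactly one of them. -/
def IsTiling (R : Set UnitTriangle) (t : Finset Lozenge) : Prop :=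
  (∀ l ∈ t, l.triangles ⊆ R) ∧ ∀ T ∈ R, ∃! l, l ∈ t ∧ T ∈ l.triangles

/-- A hexagon has only finitely many lozenge tilings. -/
theorem finite_tilings (a b c : ℕ) : {t | IsTiling (hexagon a b c) t}.Finite := by
  set B : Set (ℤ × ℤ) :=
    Set.Icc (0 : ℤ) (b + c) ×ˢ Set.Icc (-(c : ℤ)) (a + 1) with hB
  have hBf : B.Finite := (Set.finite_Icc _ _).prod (Set.finite_Icc _ _)
  set s : Set Lozenge := (fun p : ℤ × ℤ => Lozenge.horizontal p.1 p.2) '' B ∪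
    (fun p : ℤ × ℤ => Lozenge.negative p.1 p.2) '' B ∪
    (fun p : ℤ × ℤ => Lozenge.positive p.1 p.2) '' B with hs
  have hsf : s.Finite := ((hBf.image _).union (hBf.image _)).union (hBf.image _)
  refine hsf.toFinset.powerset.finite_toSet.subset ?_
  rintro t ⟨ht, -⟩
  rw [Finset.mem_coe, Finset.mem_powerset]
  intro l hl
  rw [Set.Finite.mem_toFinset]
  have h := ht l hl
  rcases l with ⟨x, y⟩ | ⟨x, y⟩ | ⟨x, y⟩ <;>
  · simp only [Lozenge.triangles, Set.insert_subset_iff, Set.singleton_subset_iff, hexagon,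
      hexagonPoints, UnitTriangle.vertices, Set.mem_ofPred_eq] at h
    simp only [hs, hB, Set.mem_union, Set.mem_image, Set.mem_prod, Set.mem_Icc, Prod.exists,
      Lozenge.horizontal.injEq, Lozenge.negative.injEq, Lozenge.positive.injEq, reduceCtorEq,
      and_false, exists_false, or_false, false_or]
    exact ⟨x, y, by omega, rfl, rfl⟩

/-- The `i`-coordinate (height) of the lattice point `(x, y)`.  The `i`-axis points up, its unit is
half the side length of a unit triangle, and the line `i = k` is the perpendicular
bisector of the left side of `H_{a,b,c}`, which has endpoints `(0, 0)` and `(0, a)`. -/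
def iCoord (a : ℕ) (k : ℤ) (x y : ℤ) : ℤ := k - a + x + 2 * y

/-- The weight of a lozenge: `(X q^n + Y q^(-n)) / 2` for a horizontal lozenge whose center has
`i`-coordinate `n`, and `1` for the other lozenges.  The center of a horizontal
lozenge is the midpoint of the shared edge, and lies one half side length above the lower endpoint
of that edge. -/
def lozengeWeight {K : Type*} [Field K] (q X Y : K) (a : ℕ) (k : ℤ) : Lozenge → K
  | .horizontal x y =>
      (X * q ^ (iCoord a k x y + 1) + Y * q ^ (-(iCoord a k x y + 1))) / 2
  | .negative _ _ => 1
  | .positive _ _ => 1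

/-- The tiling generating function `M_{(q,X,Y,k)}(H_{a,b,c})`: the sum over all lozenge tilings of
the product of the weights of their lozenges. -/
noncomputable def tilingGF {K : Type*} [Field K] (q X Y : K) (k : ℤ) (a b c : ℕ) : K :=
  ∑ t ∈ (finite_tilings a b c).toFinset, ∏ l ∈ t, lozengeWeight q X Y a k l

/-- The `q`-integer `⟨n⟩_q = (q^n - q^(-n)) / (q - q^(-1))`. -/
def qInt {K : Type*} [Field K] (q : K) (n : ℕ) : K := (q ^ (n : ℤ) - q ^ (-(n : ℤ))) / (q - q⁻¹)

/-- The `q`-factorial `⟨n⟩_q! = ⟨1⟩_q ⟨2⟩_q ⋯ ⟨n⟩_q`. -/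
def qFactorial {K : Type*} [Field K] (q : K) (n : ℕ) : K := ∏ i ∈ Finset.Icc 1 n, qInt q i

/-- The `q`-superfactorial `H_q(n) = ⟨0⟩_q! ⟨1⟩_q! ⋯ ⟨n-1⟩_q!`, with `H_q(0) = 1`. -/
def qSuperfactorial {K : Type*} [Field K] (q : K) (n : ℕ) : K := ∏ i ∈ Finset.range n, qFactorial q i

end LozengeTiling

/-!
The weighted tilings are counted by a transfer operator that moves through the hexagon from one
vertical lattice line to the next. On the line `x = m` exactly `a` vertical unit edges are crossed by
no horizontal lozenge. Between consecutive lines each of them continues through a lozenge of negative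
slope (its second coordinate drops by one) or of positive slope (the coordinate stays), and no two
may collide. These `a` edges determine the horizontal lozenges, and a tiling of the part of the
hexagon to the right of `x = m` amounts to one choice of slopes and a tiling of the part to the right
of `x = m + 1` (`exists_of_isTiling_rightPart`, `isTiling_rightPart_of_lower`).

The weighted number of tilings of the right part is proportional to a Vandermonde determinant in the
variables `X q ^ n - Y q ^ (-n)`, with `n` the heights of the `a` edges, times a product of
one-variable factors (`stateWeight`, `exists_tilings_rightPart`). The reason is
`sum_stateWeight_lower`: the determinant is multilinear in its rows, so summing over all choices of
slopes can be done row by row; in each row one meets a difference operator of `q`-Racah type, which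
maps the `j`-th power of the variable to the weight times a polynomial of degree at most `j` whose
`j`-th coefficient is a `q`-integer (`transfer_pow`, `coeff_transferPoly`). The result is triangular with
respect to the Vandermonde matrix. Collisions need no attention because the determinant vanishes on
them.

Comparing the left and the right side of the hexagon gives the number of tilings as a product, which
`prod_qIntZ_mul_qSuperfactorial` and `prod_grid_comm` bring into the final form. This comparison
divides by weights `X q ^ n + Y q ^ (-n)`, so it is carried out for a generic `X` first
(`sum_tilings_of_ne_zero`) and then specialized (`sum_tilings`). The factor `1 / 2` is absorbed in
`X` and `Y`.
-/

namespace LozengeTiling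

/-! ### Cutting tilings along vertical lines -/

theorem right_mem_hexagon {a b c : ℕ} {x y : ℤ} :
    UnitTriangle.right x y ∈ hexagon a b c ↔
      0 ≤ x ∧ x + 1 ≤ b + c ∧ -(c : ℤ) ≤ y ∧ y + 1 ≤ a ∧ 0 ≤ x + y ∧ x + y + 1 ≤ a + b := by
  simp only [hexagon, hexagonPoints, UnitTriangle.vertices, Set.insert_subset_iff,
    Set.singleton_subset_iff, Set.mem_ofPred_eq]
  omega

theorem left_mem_hexagon {a b c : ℕ} {x y : ℤ} :
    UnitTriangle.left x y ∈ hexagon a b c ↔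
      1 ≤ x ∧ x ≤ b + c ∧ -(c : ℤ) ≤ y ∧ y + 1 ≤ a ∧ 0 ≤ x + y ∧ x + y + 1 ≤ a + b := by
  simp only [hexagon, hexagonPoints, UnitTriangle.vertices, Set.insert_subset_iff,
    Set.singleton_subset_iff, Set.mem_ofPred_eq]
  omega

/-- The vertical unit edges of the closed hexagon on the line `x = m`, each given by the second
coordinate of its lower endpoint. -/
noncomputable def edges (a b c m : ℕ) : Finset ℤ :=
  Finset.Icc (max (-(c : ℤ)) (-(m : ℤ))) (min ((a : ℤ) - 1) ((a : ℤ) + b - m - 1))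

theorem mem_edges {a b c m : ℕ} {z : ℤ} :
    z ∈ edges a b c m ↔
      -(c : ℤ) ≤ z ∧ z + 1 ≤ a ∧ 0 ≤ (m : ℤ) + z ∧ (m : ℤ) + z + 1 ≤ a + b := by
  simp only [edges, Finset.mem_Icc]
  omega

/-- The part of the hexagon `H_{a,b,c}` to the right of the line `x = m`, together with the
left-pointing triangles that abut that line from the left at the edges not listed by `y`.
If a tiling of the hexagon has horizontal lozenges across exactly those edges of the line, this is the
region covered by its lozenges whose right-pointing triangle lies to the right of the line. -/
def rightPart (a b c m : ℕ) (y : Fin a → ℤ) : Set UnitTriangle :=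
  {T | match T with
    | .right x z => (m : ℤ) ≤ x ∧ .right x z ∈ hexagon a b c
    | .left x z => ((m : ℤ) < x ∧ .left x z ∈ hexagon a b c) ∨
        (x = m ∧ z ∈ edges a b c m ∧ z ∉ Set.range y)}

theorem right_mem_rightPart {a b c m : ℕ} {y : Fin a → ℤ} {x z : ℤ} :
    UnitTriangle.right x z ∈ rightPart a b c m y ↔
      (m : ℤ) ≤ x ∧ UnitTriangle.right x z ∈ hexagon a b c := Iff.rfl

theorem left_mem_rightPart {a b c m : ℕ} {y : Fin a → ℤ} {x z : ℤ} :
    UnitTriangle.left x z ∈ rightPart a b c m y ↔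
      ((m : ℤ) < x ∧ UnitTriangle.left x z ∈ hexagon a b c) ∨
        (x = m ∧ z ∈ edges a b c m ∧ z ∉ Set.range y) := Iff.rfl

/-- The result of moving down by one the entries of `y` with index in `D`. -/
def lower {a : ℕ} (y : Fin a → ℤ) (D : Finset (Fin a)) : Fin a → ℤ :=
  D.piecewise (fun i => y i - 1) y

theorem lower_of_mem {a : ℕ} (y : Fin a → ℤ) {D : Finset (Fin a)} {i : Fin a} (h : i ∈ D) :
    lower y D i = y i - 1 := Finset.piecewise_eq_of_mem _ _ _ h

theorem lower_of_notMem {a : ℕ} (y : Fin a → ℤ) {D : Finset (Fin a)} {i : Fin a} (h : i ∉ D) :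
    lower y D i = y i := Finset.piecewise_eq_of_notMem _ _ _ h

/-- The column of a lozenge: the abscissa of the vertical side of its right-pointing triangle. -/
def Lozenge.column : Lozenge → ℤ
  | .horizontal x _ => x
  | .negative x _ => x
  | .positive x _ => x

open Classical in
/-- The lozenges in column `m` when the edges listed by `y` are those crossed by no horizontal
lozenge, and the ones with index in `D` are followed by a lozenge of negative slope. -/
noncomputable def columnLozenges (a b c m : ℕ) (y : Fin a → ℤ) (D : Finset (Fin a)) :
    Finset Lozenge :=
  ((edges a b c m \ Finset.univ.image y).image fun z => Lozenge.horizontal m z) ∪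
    Finset.univ.image fun i =>
      if i ∈ D then Lozenge.negative m (y i) else Lozenge.positive m (y i + 1)

theorem mem_columnLozenges {a b c m : ℕ} {y : Fin a → ℤ} {D : Finset (Fin a)} {l : Lozenge} :
    l ∈ columnLozenges a b c m y D ↔
      (∃ z ∈ edges a b c m, z ∉ Set.range y ∧ l = .horizontal m z) ∨
      (∃ i ∈ D, l = .negative m (y i)) ∨ (∃ i ∉ D, l = .positive m (y i + 1)) := by
  classical
  simp only [columnLozenges, Finset.mem_union, Finset.mem_image, Finset.mem_sdiff,
    Finset.mem_univ, true_and, Set.mem_range]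
  constructor
  · rintro (⟨z, ⟨h1, h2⟩, rfl⟩ | ⟨i, rfl⟩)
    · exact .inl ⟨z, h1, h2, rfl⟩
    · by_cases hi : i ∈ D
      · exact .inr (.inl ⟨i, hi, by simp [hi]⟩)
      · exact .inr (.inr ⟨i, hi, by simp [hi]⟩)
  · rintro (⟨z, h1, h2, rfl⟩ | ⟨i, hi, rfl⟩ | ⟨i, hi, rfl⟩)
    · exact .inl ⟨z, ⟨h1, h2⟩, rfl⟩
    · exact .inr ⟨i, by simp [hi]⟩
    · exact .inr ⟨i, by simp [hi]⟩

theorem column_of_mem_columnLozenges {a b c m : ℕ} {y : Fin a → ℤ} {D : Finset (Fin a)}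
    {l : Lozenge} (h : l ∈ columnLozenges a b c m y D) : l.column = m := by
  rcases mem_columnLozenges.1 h with ⟨z, -, -, rfl⟩ | ⟨i, -, rfl⟩ | ⟨i, -, rfl⟩ <;> rfl

theorem IsTiling.eq_of_mem {R : Set UnitTriangle} {t : Finset Lozenge} (ht : IsTiling R t)
    {l l' : Lozenge} (hl : l ∈ t) (hl' : l' ∈ t) {T : UnitTriangle} (h : T ∈ l.triangles)
    (h' : T ∈ l'.triangles) : l = l' :=
  (ht.2 T (ht.1 l hl h)).unique ⟨hl, h⟩ ⟨hl', h'⟩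

theorem right_mem_triangles {x z : ℤ} {l : Lozenge} :
    UnitTriangle.right x z ∈ l.triangles ↔
      l = .horizontal x z ∨ l = .negative x z ∨ l = .positive x (z + 1) := by
  rcases l with ⟨u, v⟩ | ⟨u, v⟩ | ⟨u, v⟩ <;> simp [Lozenge.triangles] <;> omega

theorem left_mem_triangles {x z : ℤ} {l : Lozenge} :
    UnitTriangle.left x z ∈ l.triangles ↔
      l = .horizontal x z ∨ l = .negative (x - 1) (z + 1) ∨ l = .positive (x - 1) (z + 1) := by
  rcases l with ⟨u, v⟩ | ⟨u, v⟩ | ⟨u, v⟩ <;> simp [Lozenge.triangles] <;> omega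

theorem column_ge_of_isTiling {a b c m : ℕ} {y : Fin a → ℤ} {t : Finset Lozenge}
    (ht : IsTiling (rightPart a b c m y) t) {l : Lozenge} (hl : l ∈ t) : (m : ℤ) ≤ l.column := by
  have h := ht.1 l hl
  rcases l with ⟨u, v⟩ | ⟨u, v⟩ | ⟨u, v⟩ <;>
    exact (right_mem_rightPart.1 (h (Set.mem_insert _ _))).1

theorem column_eq_or {x z : ℤ} {l : Lozenge} (h : UnitTriangle.left x z ∈ l.triangles) :
    l.column = x ∨ l.column = x - 1 := by
  rcases left_mem_triangles.1 h with rfl | rfl | rfl <;> simp [Lozenge.column]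

theorem column_eq_of_right {x z : ℤ} {l : Lozenge} (h : UnitTriangle.right x z ∈ l.triangles) :
    l.column = x := by
  rcases right_mem_triangles.1 h with rfl | rfl | rfl <;> simp [Lozenge.column]

theorem mem_of_mem_edges {a b c m : ℕ} (hm : m < b + c) {z : ℤ} (hz : z ∈ edges a b c m) :
    UnitTriangle.right m z ∈ hexagon a b c := by
  rw [mem_edges] at hz; rw [right_mem_hexagon]; omega

theorem left_mem_hexagon_iff_edges {a b c m : ℕ} (hm : m < b + c) {z : ℤ} :
    UnitTriangle.left (m + 1) z ∈ hexagon a b c ↔ z ∈ edges a b c (m + 1) := by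
  rw [mem_edges, left_mem_hexagon]; push_cast; omega

theorem horizontal_mem_of_isTiling {a b c m : ℕ} {y : Fin a → ℤ} {t : Finset Lozenge}
    (ht : IsTiling (rightPart a b c m y) t) {z : ℤ} (hz : z ∈ edges a b c m)
    (hzy : z ∉ Set.range y) : Lozenge.horizontal m z ∈ t := by
  obtain ⟨l, ⟨hl, hT⟩, -⟩ := ht.2 _ (left_mem_rightPart.2 (.inr ⟨rfl, hz, hzy⟩))
  have := column_ge_of_isTiling ht hl
  rcases left_mem_triangles.1 hT with rfl | rfl | rfl
  · exact hl
  · simp [Lozenge.column] at this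
  · simp [Lozenge.column] at this

theorem negative_or_positive_mem {a b c m : ℕ} (hm : m < b + c) {y : Fin a → ℤ}
    (hy : ∀ i, y i ∈ edges a b c m) {t : Finset Lozenge}
    (ht : IsTiling (rightPart a b c m y) t) (i : Fin a) :
    Lozenge.negative m (y i) ∈ t ∨ Lozenge.positive m (y i + 1) ∈ t := by
  obtain ⟨l, ⟨hl, hT⟩, -⟩ := ht.2 _ (right_mem_rightPart.2 ⟨le_rfl, mem_of_mem_edges hm (hy i)⟩)
  rcases right_mem_triangles.1 hT with rfl | rfl | rfl
  · have := ht.1 _ hl (show UnitTriangle.left m (y i) ∈ _ by simp [Lozenge.triangles])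
    rw [left_mem_rightPart] at this
    simp at this
  · exact .inl hl
  · exact .inr hl

/-- A tiling of `rightPart a b c m y` is cut into its lozenges in column `m` and a tiling of
`rightPart a b c (m + 1) (lower y D)`, where `D` marks the lozenges of negative slope. -/
theorem exists_of_isTiling_rightPart {a b c m : ℕ} (hm : m < b + c) {y : Fin a → ℤ}
    (hinj : Function.Injective y) (hy : ∀ i, y i ∈ edges a b c m) {t : Finset Lozenge}
    (ht : IsTiling (rightPart a b c m y) t) :
    ∃ D : Finset (Fin a), (Function.Injective (lower y D) ∧
      ∀ i, lower y D i ∈ edges a b c (m + 1)) ∧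
      ∃ t', IsTiling (rightPart a b c (m + 1) (lower y D)) t' ∧
        ∀ l, l ∈ t ↔ l ∈ columnLozenges a b c m y D ∨ l ∈ t' := by
  classical
  set D : Finset (Fin a) := Finset.univ.filter fun i => Lozenge.negative m (y i) ∈ t with hD
  have hDmem : ∀ i, i ∈ D ↔ Lozenge.negative m (y i) ∈ t := by simp [hD]
  have hpos : ∀ i, i ∉ D → Lozenge.positive m (y i + 1) ∈ t := fun i hi =>
    (negative_or_positive_mem hm hy ht i).resolve_left (fun h => hi ((hDmem i).2 h))
  -- the lozenge that starts at `y i` covers the triangle to the left of the edge `lower y D i`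
  have hstep : ∀ i, ∃ l ∈ t, l.column = m ∧ UnitTriangle.right m (y i) ∈ l.triangles ∧
      UnitTriangle.left (m + 1) (lower y D i) ∈ l.triangles := by
    intro i
    by_cases hi : i ∈ D
    · exact ⟨_, (hDmem i).1 hi, rfl, by simp [Lozenge.triangles],
        by simp [Lozenge.triangles, lower_of_mem y hi]⟩
    · exact ⟨_, hpos i hi, rfl, by simp [Lozenge.triangles],
        by simp [Lozenge.triangles, lower_of_notMem y hi]⟩
  -- a lozenge of `t` in column `m` that is not horizontal starts at some `y i`
  have hstart : ∀ l ∈ t, ∀ u, UnitTriangle.right m u ∈ l.triangles → l ≠ .horizontal m u →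
      ∃ i, y i = u := by
    intro l hl u hu hne
    by_contra hcon
    have hR := right_mem_rightPart.1 (ht.1 l hl hu)
    have hu' : u ∈ edges a b c m := by
      have := right_mem_hexagon.1 hR.2
      rw [mem_edges]; omega
    have := horizontal_mem_of_isTiling ht hu' (by simpa using hcon)
    exact hne (ht.eq_of_mem hl this hu (by simp [Lozenge.triangles]))
  refine ⟨D, ⟨?_, ?_⟩, t.filter (fun l => (m : ℤ) < l.column), ⟨?_, ?_⟩, ?_⟩
  · intro i j hij
    obtain ⟨l, hl, -, h1, h2⟩ := hstep i
    obtain ⟨l', hl', -, h1', h2'⟩ := hstep j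
    rw [hij] at h2
    obtain rfl := ht.eq_of_mem hl hl' h2 h2'
    apply hinj
    rcases right_mem_triangles.1 h1 with rfl | rfl | rfl <;>
      simpa [right_mem_triangles, eq_comm] using h1'
  · intro i
    obtain ⟨l, hl, -, h1, h2⟩ := hstep i
    have := left_mem_rightPart.1 (ht.1 l hl h2)
    rcases this with h | h
    · exact (left_mem_hexagon_iff_edges hm).1 h.2
    · omega
  · intro l hl T hT
    rw [Finset.mem_filter] at hl
    have hR := ht.1 l hl.1 hT
    rcases T with ⟨x, z⟩ | ⟨x, z⟩
    · rw [right_mem_rightPart] at hR ⊢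
      have := column_eq_of_right hT
      exact ⟨by push_cast; omega, hR.2⟩
    · rw [left_mem_rightPart] at hR ⊢
      have hx := column_eq_or hT
      have hR' : (m : ℤ) < x ∧ UnitTriangle.left x z ∈ hexagon a b c := by
        rcases hR with h | h
        · exact h
        · omega
      rcases lt_or_eq_of_le (show ((m : ℤ) + 1) ≤ x by omega) with h | rfl
      · exact .inl ⟨by push_cast; omega, hR'.2⟩
      · refine .inr ⟨by push_cast; rfl, (left_mem_hexagon_iff_edges hm).1 hR'.2, ?_⟩
        rintro ⟨i, rfl⟩
        obtain ⟨l', hl', hc, h1, h2⟩ := hstep i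
        have := ht.eq_of_mem hl.1 hl' hT h2
        rw [this] at hl
        omega
  · intro T hT
    have hTR : T ∈ rightPart a b c m y := by
      rcases T with ⟨x, z⟩ | ⟨x, z⟩
      · rw [right_mem_rightPart] at hT ⊢
        exact ⟨by push_cast at hT; omega, hT.2⟩
      · rw [left_mem_rightPart] at hT ⊢
        push_cast at hT
        rcases hT with h | ⟨rfl, h, -⟩
        · exact .inl ⟨by omega, h.2⟩
        · exact .inl ⟨by omega, (left_mem_hexagon_iff_edges hm).2 h⟩
    obtain ⟨l, ⟨hl, hTl⟩, huniq⟩ := ht.2 T hTR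
    refine ⟨l, ⟨Finset.mem_filter.2 ⟨hl, ?_⟩, hTl⟩, fun l' h =>
      huniq l' ⟨(Finset.mem_filter.1 h.1).1, h.2⟩⟩
    rcases T with ⟨x, z⟩ | ⟨x, z⟩
    · rw [right_mem_rightPart] at hT
      rw [column_eq_of_right hTl]
      push_cast at hT; omega
    · rw [left_mem_rightPart] at hT
      push_cast at hT
      rcases hT with h | ⟨rfl, h, hz⟩
      · have := column_eq_or hTl
        omega
      · have key : ∀ u, UnitTriangle.right m u ∈ l.triangles → l ≠ .horizontal m u → False := by
          intro u hu hne
          obtain ⟨i, rfl⟩ := hstart l hl u hu hne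
          obtain ⟨l', hl', hc, h1, h2⟩ := hstep i
          obtain rfl := ht.eq_of_mem hl hl' hu h1
          apply hz
          refine ⟨i, ?_⟩
          rcases left_mem_triangles.1 hTl with rfl | rfl | rfl <;>
            simpa [Lozenge.triangles] using h2
        rcases left_mem_triangles.1 hTl with rfl | rfl | rfl
        · simp [Lozenge.column]
        · exact (key (z + 1) (by simp [Lozenge.triangles]) (by simp)).elim
        · exact (key z (by simp [Lozenge.triangles]) (by simp)).elim
  · intro l
    rw [Finset.mem_filter, mem_columnLozenges]
    constructor
    · intro hl
      rcases (column_ge_of_isTiling ht hl).lt_or_eq with h | h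
      · exact .inr ⟨hl, h⟩
      left
      rcases l with ⟨x, z⟩ | ⟨x, z⟩ | ⟨x, z⟩ <;> obtain rfl : (m : ℤ) = x := h
      · left
        have := left_mem_rightPart.1 (ht.1 _ hl
          (show UnitTriangle.left m z ∈ _ by simp [Lozenge.triangles]))
        rcases this with h | h
        · omega
        · exact ⟨z, h.2.1, h.2.2, rfl⟩
      · obtain ⟨i, rfl⟩ := hstart _ hl z (by simp [Lozenge.triangles]) (by simp)
        exact .inr (.inl ⟨i, (hDmem i).2 hl, rfl⟩)
      · obtain ⟨i, hi⟩ := hstart _ hl (z - 1) (by simp [Lozenge.triangles]) (by simp)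
        obtain rfl : z = y i + 1 := by omega
        refine .inr (.inr ⟨i, fun hiD => ?_, rfl⟩)
        have := ht.eq_of_mem hl ((hDmem i).1 hiD) (T := .right m (y i))
          (by simp [Lozenge.triangles]) (by simp [Lozenge.triangles])
        simp at this
    · rintro ((⟨z, h1, h2, rfl⟩ | ⟨i, hi, rfl⟩ | ⟨i, hi, rfl⟩) | h)
      · exact horizontal_mem_of_isTiling ht h1 h2
      · exact (hDmem i).1 hi
      · exact hpos i hi
      · exact h.1

/-- Conversely, a tiling of `rightPart a b c (m + 1) (lower y D)` is completed by the lozenges in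
column `m` to a tiling of `rightPart a b c m y`. -/
theorem isTiling_rightPart_of_lower {a b c m : ℕ} (hm : m < b + c) {y : Fin a → ℤ}
    (hinj : Function.Injective y) (hy : ∀ i, y i ∈ edges a b c m) {D : Finset (Fin a)}
    (hDinj : Function.Injective (lower y D)) (hD : ∀ i, lower y D i ∈ edges a b c (m + 1))
    {t t' : Finset Lozenge} (ht' : IsTiling (rightPart a b c (m + 1) (lower y D)) t')
    (ht : ∀ l, l ∈ t ↔ l ∈ columnLozenges a b c m y D ∨ l ∈ t') :
    IsTiling (rightPart a b c m y) t := by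
  have hcol : ∀ l ∈ t', (m : ℤ) + 1 ≤ l.column := fun l hl => by
    have := column_ge_of_isTiling ht' hl
    push_cast at this; exact this
  have hmono : rightPart a b c (m + 1) (lower y D) ⊆ rightPart a b c m y := by
    rintro (⟨x, z⟩ | ⟨x, z⟩) hT
    · rw [right_mem_rightPart] at hT ⊢
      exact ⟨by push_cast at hT; omega, hT.2⟩
    · rw [left_mem_rightPart] at hT ⊢
      push_cast at hT
      rcases hT with h | ⟨rfl, h, -⟩
      · exact .inl ⟨by omega, h.2⟩
      · exact .inl ⟨by omega, (left_mem_hexagon_iff_edges hm).2 h⟩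
  constructor
  · intro l hl
    rcases (ht l).1 hl with h | h
    · rcases mem_columnLozenges.1 h with ⟨z, h1, h2, rfl⟩ | ⟨i, hi, rfl⟩ | ⟨i, hi, rfl⟩
      · simp only [Lozenge.triangles, Set.insert_subset_iff, Set.singleton_subset_iff,
          right_mem_rightPart, left_mem_rightPart]
        exact ⟨⟨le_rfl, mem_of_mem_edges hm h1⟩, .inr ⟨trivial, h1, h2⟩⟩
      · have := hD i
        rw [lower_of_mem y hi] at this
        simp only [Lozenge.triangles, Set.insert_subset_iff, Set.singleton_subset_iff,
          right_mem_rightPart, left_mem_rightPart]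
        exact ⟨⟨le_rfl, mem_of_mem_edges hm (hy i)⟩,
          .inl ⟨by omega, (left_mem_hexagon_iff_edges hm).2 this⟩⟩
      · have := hD i
        rw [lower_of_notMem y hi] at this
        simp only [Lozenge.triangles, Set.insert_subset_iff, Set.singleton_subset_iff,
          right_mem_rightPart, left_mem_rightPart, add_sub_cancel_right]
        exact ⟨⟨le_rfl, mem_of_mem_edges hm (hy i)⟩,
          .inl ⟨by omega, (left_mem_hexagon_iff_edges hm).2 this⟩⟩
    · exact (ht'.1 l h).trans hmono
  · -- triangles of the smaller region are not covered by the lozenges in column `m`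
    have hnew : ∀ T ∈ rightPart a b c (m + 1) (lower y D), ∀ l ∈ columnLozenges a b c m y D,
        T ∉ l.triangles := by
      intro T hT l hl hTl
      have hc := column_of_mem_columnLozenges hl
      rcases T with ⟨x, z⟩ | ⟨x, z⟩
      · rw [right_mem_rightPart, ← column_eq_of_right hTl, hc] at hT
        push_cast at hT; omega
      · rw [left_mem_rightPart] at hT
        push_cast at hT
        rcases hT with h | ⟨rfl, h, hz⟩
        · have := column_eq_or hTl
          omega
        · apply hz
          rcases mem_columnLozenges.1 hl with ⟨z, h1, h2, rfl⟩ | ⟨i, hi, rfl⟩ | ⟨i, hi, rfl⟩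
          · simp [Lozenge.triangles] at hTl
          · exact ⟨i, by rw [lower_of_mem y hi]; simp [Lozenge.triangles] at hTl; omega⟩
          · exact ⟨i, by rw [lower_of_notMem y hi]; simp [Lozenge.triangles] at hTl; omega⟩
    intro T hT
    by_cases hTR : T ∈ rightPart a b c (m + 1) (lower y D)
    · obtain ⟨l, ⟨hl, hTl⟩, huniq⟩ := ht'.2 T hTR
      refine ⟨l, ⟨(ht l).2 (.inr hl), hTl⟩, fun l' h => ?_⟩
      rcases (ht l').1 h.1 with h' | h'
      · exact (hnew T hTR l' h' h.2).elim
      · exact huniq l' ⟨h', h.2⟩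
    -- the remaining triangles are covered by lozenges in column `m` only
    suffices ∃! l, l ∈ columnLozenges a b c m y D ∧ T ∈ l.triangles by
      obtain ⟨l, ⟨hl, hTl⟩, huniq⟩ := this
      refine ⟨l, ⟨(ht l).2 (.inl hl), hTl⟩, fun l' h => ?_⟩
      rcases (ht l').1 h.1 with h' | h'
      · exact huniq l' ⟨h', h.2⟩
      · exact (hTR (ht'.1 l' h' h.2)).elim
    rcases T with ⟨x, z⟩ | ⟨x, z⟩
    · rw [right_mem_rightPart] at hT hTR
      push_cast at hTR
      obtain rfl : x = m := by
        by_contra hne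
        exact hTR ⟨by omega, hT.2⟩
      have hz : z ∈ edges a b c m := by
        have := right_mem_hexagon.1 hT.2
        rw [mem_edges]; omega
      by_cases hzy : z ∈ Set.range y
      · obtain ⟨i, rfl⟩ := hzy
        by_cases hi : i ∈ D
        · refine ⟨.negative m (y i), ⟨mem_columnLozenges.2 (.inr (.inl ⟨i, hi, rfl⟩)),
            by simp [Lozenge.triangles]⟩, ?_⟩
          rintro l ⟨hl, hTl⟩
          rcases mem_columnLozenges.1 hl with ⟨z, h1, h2, rfl⟩ | ⟨j, hj, rfl⟩ | ⟨j, hj, rfl⟩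
          · simp [Lozenge.triangles] at hTl
            exact (h2 ⟨i, hTl⟩).elim
          · simp [Lozenge.triangles] at hTl
            rw [hTl]
          · simp [Lozenge.triangles] at hTl
            rw [hinj hTl] at hi
            exact (hj hi).elim
        · refine ⟨.positive m (y i + 1), ⟨mem_columnLozenges.2 (.inr (.inr ⟨i, hi, rfl⟩)),
            by simp [Lozenge.triangles]⟩, ?_⟩
          rintro l ⟨hl, hTl⟩
          rcases mem_columnLozenges.1 hl with ⟨z, h1, h2, rfl⟩ | ⟨j, hj, rfl⟩ | ⟨j, hj, rfl⟩
          · simp [Lozenge.triangles] at hTl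
            exact (h2 ⟨i, hTl⟩).elim
          · simp [Lozenge.triangles] at hTl
            rw [hinj hTl] at hi
            exact (hi hj).elim
          · simp [Lozenge.triangles] at hTl
            rw [hTl]
      · refine ⟨.horizontal m z, ⟨mem_columnLozenges.2 (.inl ⟨z, hz, hzy, rfl⟩),
          by simp [Lozenge.triangles]⟩, ?_⟩
        rintro l ⟨hl, hTl⟩
        rcases mem_columnLozenges.1 hl with ⟨z, h1, h2, rfl⟩ | ⟨j, hj, rfl⟩ | ⟨j, hj, rfl⟩
        · simp [Lozenge.triangles] at hTl
          rw [hTl]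
        · simp [Lozenge.triangles] at hTl
          exact (hzy ⟨j, hTl.symm⟩).elim
        · simp [Lozenge.triangles] at hTl
          exact (hzy ⟨j, hTl.symm⟩).elim
    · rw [left_mem_rightPart] at hT hTR
      push_cast at hTR
      rcases hT with ⟨hx, hhex⟩ | ⟨rfl, hz, hzy⟩
      · obtain rfl : x = m + 1 := by
          by_contra hne
          exact hTR (.inl ⟨by omega, hhex⟩)
        have hz := (left_mem_hexagon_iff_edges hm).1 hhex
        have : z ∈ Set.range (lower y D) := by
          by_contra hne
          exact hTR (.inr ⟨rfl, hz, hne⟩)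
        obtain ⟨i, rfl⟩ := this
        have hother : ∀ l ∈ columnLozenges a b c m y D,
            UnitTriangle.left (m + 1) (lower y D i) ∈ l.triangles →
            l = if i ∈ D then .negative m (y i) else .positive m (y i + 1) := by
          intro l hl hTl
          rcases mem_columnLozenges.1 hl with ⟨z, h1, h2, rfl⟩ | ⟨j, hj, rfl⟩ | ⟨j, hj, rfl⟩
          · simp [Lozenge.triangles] at hTl
          · have : lower y D i = lower y D j := by
              rw [lower_of_mem y hj]; simpa [Lozenge.triangles] using hTl
            obtain rfl := hDinj this
            simp [hj]
          · have : lower y D i = lower y D j := by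
              rw [lower_of_notMem y hj]; simpa [Lozenge.triangles] using hTl
            obtain rfl := hDinj this
            simp [hj]
        refine ⟨_, ⟨?_, ?_⟩, fun l h => hother l h.1 h.2⟩
        · rw [mem_columnLozenges]
          by_cases hi : i ∈ D
          · exact .inr (.inl ⟨i, hi, by simp [hi]⟩)
          · exact .inr (.inr ⟨i, hi, by simp [hi]⟩)
        · by_cases hi : i ∈ D
          · simp [hi, Lozenge.triangles, lower_of_mem y hi]
          · simp [hi, Lozenge.triangles, lower_of_notMem y hi]
      · refine ⟨.horizontal m z, ⟨mem_columnLozenges.2 (.inl ⟨z, hz, hzy, rfl⟩),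
          by simp [Lozenge.triangles]⟩, ?_⟩
        rintro l ⟨hl, hTl⟩
        have hc := column_of_mem_columnLozenges hl
        rcases left_mem_triangles.1 hTl with rfl | rfl | rfl
        · rfl
        · simp [Lozenge.column] at hc
        · simp [Lozenge.column] at hc

/-! ### The transfer operator -/

section Step

variable {K : Type*} [Field K]

/-- The `q`-integer `⟨n⟩_q` for an arbitrary integer `n`. -/
def qIntZ (q : K) (n : ℤ) : K := (q ^ n - q ^ (-n)) / (q - q⁻¹)

/-- The weight `X q ^ n + Y q ^ (-n)` of a horizontal lozenge at height `n`. -/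
def heightWeight (q X Y : K) (n : ℤ) : K := X * q ^ n + Y * q ^ (-n)

/-- The variable `X q ^ n - Y q ^ (-n)` in which the transfer operator is triangular on
polynomials. -/
def spectral (q X Y : K) (n : ℤ) : K := X * q ^ n - Y * q ^ (-n)

theorem sub_inv_ne_zero {q : K} (hq0 : q ≠ 0) (hq : q ^ 2 ≠ 1) : q - q⁻¹ ≠ 0 := by
  intro h
  apply hq
  have : q * (q - q⁻¹) = 0 := by rw [h, mul_zero]
  rw [mul_sub, mul_inv_cancel₀ hq0] at this
  linear_combination this

theorem qIntZ_zero (q : K) : qIntZ q 0 = 0 := by simp [qIntZ]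

theorem qIntZ_sub_one_sub_one {q : K} (hq0 : q ≠ 0) (n : ℤ) :
    qIntZ q (n - 1 - 1) = (q + q⁻¹) * qIntZ q (n - 1) - qIntZ q n := by
  have hz : q ^ n ≠ 0 := zpow_ne_zero _ hq0
  simp only [qIntZ, ← mul_div_assoc, ← sub_div]
  congr 1
  simp only [zpow_neg, zpow_sub₀ hq0, zpow_one]
  field_simp
  ring

theorem spectral_sub_spectral {q : K} (hq0 : q ≠ 0) (hq : q ^ 2 ≠ 1) (X Y : K) (s t : ℤ) :
    spectral q X Y (t + s) - spectral q X Y (t - s) =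
      (q - q⁻¹) * (qIntZ q s * heightWeight q X Y t) := by
  have hd := sub_inv_ne_zero hq0 hq
  have hs : q ^ s ≠ 0 := zpow_ne_zero _ hq0
  have ht : q ^ t ≠ 0 := zpow_ne_zero _ hq0
  have : (q - q⁻¹) * (qIntZ q s * heightWeight q X Y t) =
      (q ^ s - q ^ (-s)) * heightWeight q X Y t := by
    rw [qIntZ]; field_simp
  rw [this]
  simp only [spectral, heightWeight, zpow_neg, zpow_sub₀ hq0, zpow_add₀ hq0]
  field_simp
  ring

open Polynomial in
/-- The polynomials by which the transfer operator acts on powers of `spectral q X Y n`, see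
`transfer_pow`. -/
noncomputable def transferPoly (q X Y M : K) (N : ℤ) : ℕ → K[X]
  | 0 => C (qIntZ q N)
  | 1 => C (qIntZ q (N - 1)) * Polynomial.X + C M
  | j + 2 => C (q + q⁻¹) * (Polynomial.X * transferPoly q X Y M N (j + 1)) -
      (Polynomial.X ^ 2 * transferPoly q X Y M N j -
        C (X * Y * (q - q⁻¹) ^ 2) * transferPoly q X Y M N j)

open Polynomial in
theorem natDegree_transferPoly_le (q X Y M : K) (N : ℤ) (j : ℕ) :
    (transferPoly q X Y M N j).natDegree ≤ j := by
  induction j using Nat.twoStepInduction with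
  | zero => simp [transferPoly]
  | one => exact natDegree_linear_le
  | more j h0 h1 =>
    rw [transferPoly]
    refine (natDegree_sub_le _ _).trans
      (max_le ?_ ((natDegree_sub_le _ _).trans (max_le ?_ ?_)))
    · refine (natDegree_C_mul_le _ _).trans (natDegree_mul_le.trans ?_)
      have := natDegree_X_le (R := K)
      omega
    · refine natDegree_mul_le.trans ?_
      have := natDegree_X_pow_le (R := K) 2
      omega
    · exact (natDegree_C_mul_le _ _).trans (by omega)

open Polynomial in
theorem coeff_transferPoly {q : K} (hq0 : q ≠ 0) (X Y M : K) (N : ℤ) (j : ℕ) :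
    (transferPoly q X Y M N j).coeff j = qIntZ q (N - j) := by
  induction j using Nat.twoStepInduction with
  | zero => simp [transferPoly]
  | one => simp [transferPoly, coeff_C]
  | more j h0 h1 =>
    have hdeg : (transferPoly q X Y M N j).coeff (j + 2) = 0 :=
      coeff_eq_zero_of_natDegree_lt ((natDegree_transferPoly_le ..).trans_lt (by omega))
    have hX2 : (Polynomial.X ^ 2 * transferPoly q X Y M N j).coeff (j + 2) =
        (transferPoly q X Y M N j).coeff j := coeff_X_pow_mul _ _ _
    have hX : (Polynomial.X * transferPoly q X Y M N (j + 1)).coeff (j + 2) =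
        (transferPoly q X Y M N (j + 1)).coeff (j + 1) := coeff_X_mul _ _
    rw [transferPoly, coeff_sub, coeff_sub, coeff_C_mul, coeff_C_mul, hX, hX2, hdeg, h0, h1,
      mul_zero, sub_zero]
    have := qIntZ_sub_one_sub_one hq0 (N - j)
    rw [show N - ((j + 2 : ℕ) : ℤ) = N - j - 1 - 1 by push_cast; ring,
      show N - ((j + 1 : ℕ) : ℤ) = N - j - 1 by push_cast; ring, this]

/-- The transfer operator `f ↦ α f(n + 1) + β f(n - 1)` maps the `j`-th power of `spectral q X Y`
to `heightWeight q X Y` times a polynomial of degree at most `j` in `spectral q X Y`. The two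
neighbours `spectral q X Y (n ± 1)` are the roots of a quadratic polynomial whose coefficients are
polynomials in `spectral q X Y n`, whence a three-term recursion in `j`. -/
theorem transfer_pow {q : K} (hq0 : q ≠ 0) (hq : q ^ 2 ≠ 1) (X Y M : K) (N n : ℤ) (j : ℕ) :
    (M - spectral q X Y (n - N)) / (q - q⁻¹) * spectral q X Y (n + 1) ^ j +
      (spectral q X Y (n + N) - M) / (q - q⁻¹) * spectral q X Y (n - 1) ^ j =
    heightWeight q X Y n * (transferPoly q X Y M N j).eval (spectral q X Y n) := by
  have hd := sub_inv_ne_zero hq0 hq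
  have hz : q ^ n ≠ 0 := zpow_ne_zero _ hq0
  have hN : q ^ N ≠ 0 := zpow_ne_zero _ hq0
  have hquad : ∀ x, x = spectral q X Y (n + 1) ∨ x = spectral q X Y (n - 1) →
      x ^ 2 = (q + q⁻¹) * spectral q X Y n * x -
        (spectral q X Y n ^ 2 - X * Y * (q - q⁻¹) ^ 2) := by
    rintro x (rfl | rfl)
    all_goals
      simp only [spectral, zpow_neg, zpow_sub₀ hq0, zpow_add₀ hq0, zpow_one]
      field_simp
      ring
  induction j using Nat.twoStepInduction with
  | zero =>
    have := spectral_sub_spectral hq0 hq X Y N n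
    simp only [pow_zero, transferPoly, Polynomial.eval_C, mul_one]
    rw [← add_div, div_eq_iff hd]
    linear_combination this
  | one =>
    simp only [pow_one, transferPoly, Polynomial.eval_add, Polynomial.eval_mul,
      Polynomial.eval_C, Polynomial.eval_X]
    rw [div_mul_eq_mul_div, div_mul_eq_mul_div, ← add_div, div_eq_iff hd]
    have h1 : qIntZ q (N - 1) * (q - q⁻¹) = q ^ (N - 1) - q ^ (-(N - 1)) := by
      rw [qIntZ]; field_simp
    have h2 := spectral_sub_spectral hq0 hq X Y 1 n
    have h3 : spectral q X Y (n + N) * spectral q X Y (n - 1) -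
        spectral q X Y (n - N) * spectral q X Y (n + 1) =
        (q ^ (N - 1) - q ^ (-(N - 1))) * heightWeight q X Y n * spectral q X Y n := by
      simp only [spectral, heightWeight, zpow_neg, zpow_sub₀ hq0, zpow_add₀ hq0, zpow_one]
      field_simp
      ring
    have h4 : qIntZ q 1 = 1 := by simp [qIntZ, hd]
    rw [h4] at h2
    linear_combination h3 - heightWeight q X Y n * spectral q X Y n * h1 + M * h2
  | more j h0 h1 =>
    have hs := hquad _ (.inl rfl)
    have ht := hquad _ (.inr rfl)
    simp only [transferPoly, Polynomial.eval_sub, Polynomial.eval_mul, Polynomial.eval_C,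
      Polynomial.eval_X, Polynomial.eval_pow]
    linear_combination
      (M - spectral q X Y (n - N)) / (q - q⁻¹) * spectral q X Y (n + 1) ^ j * hs +
      (spectral q X Y (n + N) - M) / (q - q⁻¹) * spectral q X Y (n - 1) ^ j * ht +
      (q + q⁻¹) * spectral q X Y n * h1 -
      (spectral q X Y n ^ 2 - X * Y * (q - q⁻¹) ^ 2) * h0

/-- Summing a weighted Vandermonde determinant in `spectral q X Y` over all ways to move every
variable up or down by one multiplies it by an explicit factor. -/
theorem sum_det_vandermonde_spectral {q : K} (hq0 : q ≠ 0) (hq : q ^ 2 ≠ 1) (X Y M : K) (N : ℤ)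
    {a : ℕ} (n : Fin a → ℤ) :
    ∑ D : Finset (Fin a),
      (∏ i, D.piecewise (fun i => (spectral q X Y (n i + N) - M) / (q - q⁻¹))
        (fun i => (M - spectral q X Y (n i - N)) / (q - q⁻¹)) i) *
      (Matrix.vandermonde (D.piecewise (fun i => spectral q X Y (n i - 1))
        fun i => spectral q X Y (n i + 1))).det =
    (∏ j ∈ Finset.range a, qIntZ q (N - j)) * (∏ i, heightWeight q X Y (n i)) *
      (Matrix.vandermonde fun i => spectral q X Y (n i)).det := by
  set α : Fin a → K := fun i => (M - spectral q X Y (n i - N)) / (q - q⁻¹) with hα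
  set β : Fin a → K := fun i => (spectral q X Y (n i + N) - M) / (q - q⁻¹) with hβ
  have hadd := (Matrix.detRowAlternating (n := Fin a) (R := K)).toMultilinearMap.map_add_univ
    (fun i j => β i * spectral q X Y (n i - 1) ^ (j : ℕ))
    (fun i j => α i * spectral q X Y (n i + 1) ^ (j : ℕ))
  have hterm : ∀ D : Finset (Fin a),
      (∏ i, D.piecewise β α i) * (Matrix.vandermonde (D.piecewise
        (fun i => spectral q X Y (n i - 1)) fun i => spectral q X Y (n i + 1))).det =
      Matrix.det (D.piecewise (fun i j => β i * spectral q X Y (n i - 1) ^ (j : ℕ))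
        (fun i j => α i * spectral q X Y (n i + 1) ^ (j : ℕ)) : Matrix (Fin a) (Fin a) K) := by
    intro D
    rw [← Matrix.det_mul_column]
    congr 1
    ext i j
    by_cases hi : i ∈ D <;> simp [hi, Matrix.vandermonde_apply]
  rw [Finset.sum_congr rfl fun D _ => hterm D]
  refine hadd.symm.trans ?_
  have hmat : ((fun i (j : Fin a) => β i * spectral q X Y (n i - 1) ^ (j : ℕ)) +
      (fun i (j : Fin a) => α i * spectral q X Y (n i + 1) ^ (j : ℕ)) : Fin a → Fin a → K) =
      Matrix.of fun i j => heightWeight q X Y (n i) *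
        (Matrix.of fun i j : Fin a =>
          (transferPoly q X Y M N j).eval (spectral q X Y (n i))) i j := by
    ext i j
    have := transfer_pow hq0 hq X Y M N (n i) j
    simp only [Pi.add_apply, Matrix.of_apply, hα, hβ]
    rw [← this, add_comm]
  have hdet : (Matrix.of fun i j : Fin a => (transferPoly q X Y M N j).coeff i).det =
      ∏ j ∈ Finset.range a, qIntZ q (N - j) := by
    rw [Matrix.det_of_isUpperTriangular]
    · simp only [Matrix.of_apply, coeff_transferPoly hq0]
      rw [Fin.prod_univ_eq_prod_range (fun j => qIntZ q (N - j))]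
    · intro i j hij
      exact Polynomial.coeff_eq_zero_of_natDegree_lt
        ((natDegree_transferPoly_le ..).trans_lt hij)
  rw [hmat]
  change Matrix.det _ = _
  rw [Matrix.det_mul_column, Matrix.eval_matrixOfPolynomials_eq_vandermonde_mul_matrixOfPolynomials
    (fun i => spectral q X Y (n i)) (fun j => transferPoly q X Y M N j)
    (fun j => natDegree_transferPoly_le ..), Matrix.det_mul, hdet]
  ring

/-- The factor that the edge from `(x, y)` to `(x, y + 1)` acquires when a step to the right raises
`x + y` from `s` to `s + 1`. -/
def riseFactor (q X Y : K) (k : ℤ) (a b c s : ℕ) : K :=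
  qIntZ q ((a : ℤ) + b - 1 - s) * heightWeight q X Y (k - a - c + 1 + s)

/-- The factor that the edge from `(x, y)` to `(x, y + 1)` acquires when a step to the right raises
its depth `a - 1 - y` from `t` to `t + 1`. -/
def fallFactor (q X Y : K) (k : ℤ) (a b c t : ℕ) : K :=
  qIntZ q ((a : ℤ) - 1 - t + c) * heightWeight q X Y (k + a - 1 - t + b)

/-- The factor of `stateWeight` that belongs to a single edge of the line `x = m`. By
`edgeFactor_eq_zero` it contains `⟨0⟩_q` once the edge has left the hexagon, so that the boundary of
the hexagon needs no separate treatment. -/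
def edgeFactor (q X Y : K) (k : ℤ) (a b c m : ℕ) (z : ℤ) : K :=
  (∏ s ∈ Finset.range (m + z).toNat, riseFactor q X Y k a b c s) *
    ∏ t ∈ Finset.range (a - 1 - z).toNat, fallFactor q X Y k a b c t

/-- A function of the edges on the line `x = m` crossed by no horizontal lozenge which is, up to
a factor depending only on `m`, the weighted number of tilings of `rightPart a b c m y`. -/
noncomputable def stateWeight (q X Y : K) (k : ℤ) (a b c m : ℕ) (y : Fin a → ℤ) : K :=
  (∏ i, edgeFactor q X Y k a b c m (y i)) *
    (Matrix.vandermonde fun i => spectral q X Y (iCoord a k m (y i) + 1)).det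

theorem edgeFactor_succ {q : K} (hq0 : q ≠ 0) (hq : q ^ 2 ≠ 1) (X Y : K) (k : ℤ)
    {a b c m : ℕ} {z : ℤ} (hz : 0 ≤ m + z) :
    edgeFactor q X Y k a b c (m + 1) z =
      edgeFactor q X Y k a b c m z *
        ((spectral q X Y (k + b - c) -
          spectral q X Y (iCoord a k m z + 1 - ((a : ℤ) + b + c - 1 - m))) / (q - q⁻¹)) := by
  have hd := sub_inv_ne_zero hq0 hq
  have h1 : (((m + 1 : ℕ) : ℤ) + z).toNat = (m + z).toNat + 1 := by omega
  have h2 : (((m + z).toNat : ℕ) : ℤ) = m + z := by omega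
  have h3 := spectral_sub_spectral hq0 hq X Y ((a : ℤ) + b - 1 - (m + z))
    (k - a - c + 1 + (m + z))
  rw [show k - a - c + 1 + (m + z) + ((a : ℤ) + b - 1 - (m + z)) = k + b - c by ring,
    show k - a - c + 1 + (m + z) - ((a : ℤ) + b - 1 - (m + z)) =
      iCoord a k m z + 1 - ((a : ℤ) + b + c - 1 - m) by rw [iCoord]; ring] at h3
  rw [h3, edgeFactor, edgeFactor, h1, Finset.prod_range_succ, riseFactor, h2,
    mul_div_cancel_left₀ _ hd]
  ring

theorem edgeFactor_succ_sub_one {q : K} (hq0 : q ≠ 0) (hq : q ^ 2 ≠ 1) (X Y : K) (k : ℤ)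
    {a b c m : ℕ} {z : ℤ} (hz : z + 1 ≤ a) :
    edgeFactor q X Y k a b c (m + 1) (z - 1) =
      edgeFactor q X Y k a b c m z *
        ((spectral q X Y (iCoord a k m z + 1 + ((a : ℤ) + b + c - 1 - m)) -
          spectral q X Y (k + b - c)) / (q - q⁻¹)) := by
  have hd := sub_inv_ne_zero hq0 hq
  have h0 : (((m + 1 : ℕ) : ℤ) + (z - 1)).toNat = (m + z).toNat := by congr 1; push_cast; ring
  have h1 : ((a : ℤ) - 1 - (z - 1)).toNat = (a - 1 - z).toNat + 1 := by omega
  have h2 : (((a - 1 - z).toNat : ℕ) : ℤ) = a - 1 - z := by omega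
  have h3 := spectral_sub_spectral hq0 hq X Y ((a : ℤ) - 1 - (a - 1 - z) + c)
    (k + a - 1 - (a - 1 - z) + b)
  rw [show k + a - 1 - (a - 1 - z) + b + ((a : ℤ) - 1 - (a - 1 - z) + c) =
      iCoord a k m z + 1 + ((a : ℤ) + b + c - 1 - m) by rw [iCoord]; ring,
    show k + a - 1 - (a - 1 - z) + b - ((a : ℤ) - 1 - (a - 1 - z) + c) = k + b - c by ring] at h3
  rw [h3, edgeFactor, edgeFactor, h0, h1, Finset.prod_range_succ _ (a - 1 - z).toNat, fallFactor,
    h2, mul_div_cancel_left₀ _ hd]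
  ring

theorem edgeFactor_eq_zero (q X Y : K) (k : ℤ) {a b c m : ℕ} {z : ℤ} (ha : 0 < a)
    (h0 : 0 ≤ m + z) (h1 : z + 1 ≤ a) (hz : z ∉ edges a b c m) :
    edgeFactor q X Y k a b c m z = 0 := by
  rw [mem_edges] at hz
  rw [edgeFactor]
  by_cases h : -(c : ℤ) ≤ z
  · rw [Finset.prod_eq_zero (i := a + b - 1), zero_mul]
    · simp only [Finset.mem_range]; omega
    · rw [riseFactor, show (a : ℤ) + b - 1 - ((a + b - 1 : ℕ) : ℤ) = 0 by omega, qIntZ_zero,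
        zero_mul]
  · rw [mul_comm, Finset.prod_eq_zero (i := a - 1 + c), zero_mul]
    · simp only [Finset.mem_range]; omega
    · rw [fallFactor, show (a : ℤ) - 1 - ((a - 1 + c : ℕ) : ℤ) + c = 0 by omega, qIntZ_zero,
        zero_mul]

/-- The eigenvector property of `stateWeight` under one step to the right. -/
theorem sum_stateWeight_lower {q : K} (hq0 : q ≠ 0) (hq : q ^ 2 ≠ 1) (X Y : K) (k : ℤ)
    {a b c m : ℕ} {y : Fin a → ℤ} (hy : ∀ i, y i ∈ edges a b c m) :
    ∑ D : Finset (Fin a), stateWeight q X Y k a b c (m + 1) (lower y D) =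
      (∏ j ∈ Finset.range a, qIntZ q ((a : ℤ) + b + c - 1 - m - j)) *
        (∏ i, heightWeight q X Y (iCoord a k m (y i) + 1)) *
        stateWeight q X Y k a b c m y := by
  have h := sum_det_vandermonde_spectral hq0 hq X Y (spectral q X Y (k + b - c))
    ((a : ℤ) + b + c - 1 - m) (fun i => iCoord a k m (y i) + 1)
  rw [stateWeight, mul_left_comm, ← h, Finset.mul_sum]
  refine Finset.sum_congr rfl fun D _ => ?_
  rw [stateWeight, ← mul_assoc, ← Finset.prod_mul_distrib]
  congr 1
  · refine Finset.prod_congr rfl fun i _ => ?_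
    have := mem_edges.1 (hy i)
    by_cases hi : i ∈ D
    · rw [lower_of_mem y hi, Finset.piecewise_eq_of_mem _ _ _ hi,
        edgeFactor_succ_sub_one hq0 hq X Y k (by omega)]
    · rw [lower_of_notMem y hi, Finset.piecewise_eq_of_notMem _ _ _ hi,
        edgeFactor_succ hq0 hq X Y k (by omega)]
  · congr 2
    ext i
    by_cases hi : i ∈ D
    · rw [lower_of_mem y hi, Finset.piecewise_eq_of_mem _ _ _ hi]
      congr 1
      simp only [iCoord]; push_cast; ring
    · rw [lower_of_notMem y hi, Finset.piecewise_eq_of_notMem _ _ _ hi]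
      congr 1
      simp only [iCoord]; push_cast; ring

theorem stateWeight_eq_zero_of_not_injective (q X Y : K) (k : ℤ) {a b c m : ℕ} {y : Fin a → ℤ}
    (hy : ¬ Function.Injective y) : stateWeight q X Y k a b c m y = 0 := by
  simp only [Function.Injective, not_forall] at hy
  obtain ⟨i, j, hij, hne⟩ := hy
  rw [stateWeight, Matrix.det_zero_of_row_eq hne, mul_zero]
  ext l
  simp [Matrix.vandermonde_apply, hij]

end Step

/-! ### The weighted tilings of the right part -/

section Recursion

/-- The weight of a lozenge when a horizontal lozenge at height `n` has weight `w n`. -/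
def weightAt {R : Type*} [CommRing R] (w : ℤ → R) (a : ℕ) (k : ℤ) : Lozenge → R
  | .horizontal x y => w (iCoord a k x y + 1)
  | .negative _ _ => 1
  | .positive _ _ => 1

theorem lower_strictMono {a : ℕ} {y : Fin a → ℤ} (hy : StrictMono y) {D : Finset (Fin a)}
    (hD : Function.Injective (lower y D)) : StrictMono (lower y D) := by
  refine Monotone.strictMono_of_injective (fun i j hij => ?_) hD
  rcases hij.eq_or_lt with rfl | hlt
  · exact le_rfl
  have h := hy hlt
  by_cases hi : i ∈ D <;> by_cases hj : j ∈ D <;>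
    simp only [lower_of_mem, lower_of_notMem, hi, hj, not_false_eq_true] <;> omega

theorem prod_columnLozenges {R : Type*} [CommRing R] (w : ℤ → R) {a b c m : ℕ} (k : ℤ)
    {y : Fin a → ℤ} (hinj : Function.Injective y) (hy : ∀ i, y i ∈ edges a b c m)
    (D : Finset (Fin a)) :
    (∏ l ∈ columnLozenges a b c m y D, weightAt w a k l) * ∏ i, w (iCoord a k m (y i) + 1) =
      ∏ z ∈ edges a b c m, w (iCoord a k m z + 1) := by
  classical
  have hsub : Finset.univ.image y ⊆ edges a b c m := by
    intro z hz
    obtain ⟨i, -, rfl⟩ := Finset.mem_image.1 hz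
    exact hy i
  rw [← Finset.prod_sdiff hsub, Finset.prod_image hinj.injOn, columnLozenges,
    Finset.prod_union, Finset.prod_image (by intro z _ z' _ h; simpa using h)]
  · rw [Finset.prod_eq_one (s := Finset.univ.image _), mul_one]
    · congr 1
    · intro l hl
      obtain ⟨i, -, rfl⟩ := Finset.mem_image.1 hl
      split_ifs <;> rfl
  · rw [Finset.disjoint_left]
    intro l h h'
    obtain ⟨z, -, rfl⟩ := Finset.mem_image.1 h
    obtain ⟨i, -, h⟩ := Finset.mem_image.1 h'
    split_ifs at h

/-- Nothing is left to tile on the right side of the hexagon. -/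
theorem isTiling_rightPart_last {a b c : ℕ} {y : Fin a → ℤ} (hinj : Function.Injective y)
    (hy : ∀ i, y i ∈ edges a b c (b + c)) (t : Finset Lozenge) :
    t = ∅ ↔ IsTiling (rightPart a b c (b + c) y) t := by
  classical
  have hcard : (edges a b c (b + c)).card = a := by
    rw [edges, Int.card_Icc]; push_cast; omega
  have himage : Finset.univ.image y = edges a b c (b + c) := by
    refine Finset.eq_of_subset_of_card_le ?_ ?_
    · intro z hz
      obtain ⟨i, -, rfl⟩ := Finset.mem_image.1 hz
      exact hy i
    · rw [hcard, Finset.card_image_of_injective _ hinj]; simp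
  have hempty : rightPart a b c (b + c) y = ∅ := by
    ext T
    rcases T with ⟨x, z⟩ | ⟨x, z⟩
    · rw [right_mem_rightPart, right_mem_hexagon]
      push_cast
      simp only [Set.mem_empty_iff_false, iff_false]
      omega
    · rw [left_mem_rightPart, left_mem_hexagon]
      simp only [Set.mem_empty_iff_false, iff_false]
      rintro (h | ⟨-, h, h'⟩)
      · push_cast at h; omega
      · rw [← himage] at h
        apply h'
        simpa using h
  rw [hempty]
  constructor
  · rintro rfl
    exact ⟨by simp, by simp⟩
  · intro h
    refine Finset.eq_empty_of_forall_notMem fun l hl => ?_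
    have := h.1 l hl
    rcases l with ⟨u, v⟩ | ⟨u, v⟩ | ⟨u, v⟩ <;>
      exact this (Set.mem_insert _ _)

theorem eq_of_strictMono_last {a b c : ℕ} {y : Fin a → ℤ} (hmono : StrictMono y)
    (hy : ∀ i, y i ∈ edges a b c (b + c)) : y = fun i : Fin a => (i : ℤ) - c := by
  have hcard : (edges a b c (b + c)).card = a := by
    rw [edges, Int.card_Icc]; push_cast; omega
  rw [Finset.orderEmbOfFin_unique hcard hy hmono]
  symm
  refine Finset.orderEmbOfFin_unique hcard (fun i => ?_) (fun i j hij => ?_)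
  · rw [mem_edges]; push_cast; omega
  · have : (i : ℕ) < j := hij
    show (i : ℤ) - c < (j : ℤ) - c
    omega

variable {K : Type*} [Field K]

/-- The weighted number of tilings of `rightPart a b c m y` is, up to a factor depending only on
`m`, equal to `stateWeight`. -/
theorem exists_tilings_rightPart {q : K} (hq0 : q ≠ 0) (hq : q ^ 2 ≠ 1) (X Y : K)
    (hv : ∀ n, heightWeight q X Y n ≠ 0) (k : ℤ) (a b c r : ℕ) : ∀ m, m + r = b + c → ∀ y : Fin a → ℤ, StrictMono y →
      (∀ i, y i ∈ edges a b c m) →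
    ∃ 𝒯 : Finset (Finset Lozenge), (∀ t, t ∈ 𝒯 ↔ IsTiling (rightPart a b c m y) t) ∧
      (∑ t ∈ 𝒯, ∏ l ∈ t, weightAt (heightWeight q X Y) a k l) *
        stateWeight q X Y k a b c (b + c) (fun i => (i : ℤ) - c) =
      stateWeight q X Y k a b c m y * ∏ p ∈ Finset.Ico m (b + c),
        ((∏ j ∈ Finset.range a, qIntZ q ((a : ℤ) + b + c - 1 - p - j)) *
          ∏ z ∈ edges a b c p, heightWeight q X Y (iCoord a k p z + 1)) := by
  classical
  induction r with
  | zero =>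
    rintro m rfl y hmono hy
    refine ⟨{∅}, fun t => ?_, ?_⟩
    · rw [Finset.mem_singleton]
      exact isTiling_rightPart_last hmono.injective hy t
    · simp [← eq_of_strictMono_last hmono hy]
  | succ r ih =>
    intro m hmr y hmono hy
    have hm : m < b + c := by omega
    set V : Finset (Fin a) → Prop := fun D => Function.Injective (lower y D) ∧
      ∀ i, lower y D i ∈ edges a b c (m + 1) with hV
    have hex : ∀ D, ∃ 𝒯 : Finset (Finset Lozenge), V D →
        (∀ t, t ∈ 𝒯 ↔ IsTiling (rightPart a b c (m + 1) (lower y D)) t) ∧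
        (∑ t ∈ 𝒯, ∏ l ∈ t, weightAt (heightWeight q X Y) a k l) *
          stateWeight q X Y k a b c (b + c) (fun i => (i : ℤ) - c) =
        stateWeight q X Y k a b c (m + 1) (lower y D) * ∏ p ∈ Finset.Ico (m + 1) (b + c),
          ((∏ j ∈ Finset.range a, qIntZ q ((a : ℤ) + b + c - 1 - p - j)) *
            ∏ z ∈ edges a b c p, heightWeight q X Y (iCoord a k p z + 1)) := by
      intro D
      by_cases hD : V D
      · obtain ⟨𝒯, h⟩ := ih (m + 1) (by omega) (lower y D) (lower_strictMono hmono hD.1) hD.2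
        exact ⟨𝒯, fun _ => h⟩
      · exact ⟨∅, fun h => (hD h).elim⟩
    choose 𝒯 h𝒯 using hex
    have hcol : ∀ D, V D → ∀ t ∈ 𝒯 D, ∀ l ∈ t, (m : ℤ) < l.column := by
      intro D hD t ht l hl
      have := column_ge_of_isTiling (((h𝒯 D hD).1 t).1 ht) hl
      push_cast at this; omega
    have hdisj : ∀ D, V D → ∀ t ∈ 𝒯 D, Disjoint (columnLozenges a b c m y D) t := by
      intro D hD t ht
      rw [Finset.disjoint_left]
      intro l h h'
      have h1 := column_of_mem_columnLozenges h
      have h2 := hcol D hD t ht l h'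
      omega
    have hfilter : ∀ D, V D → ∀ t ∈ 𝒯 D,
        (columnLozenges a b c m y D ∪ t).filter (fun l => (m : ℤ) < l.column) = t := by
      intro D hD t ht
      ext l
      simp only [Finset.mem_filter, Finset.mem_union]
      constructor
      · rintro ⟨h | h, h'⟩
        · have := column_of_mem_columnLozenges h
          omega
        · exact h
      · exact fun h => ⟨.inr h, hcol D hD t ht l h⟩
    have hmemD : ∀ D, V D → ∀ t ∈ 𝒯 D, ∀ i,
        i ∈ D ↔ Lozenge.negative m (y i) ∈ columnLozenges a b c m y D ∪ t := by
      intro D hD t ht i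
      rw [Finset.mem_union, mem_columnLozenges]
      constructor
      · exact fun h => .inl (.inr (.inl ⟨i, h, rfl⟩))
      · rintro ((⟨z, -, -, h⟩ | ⟨j, hj, h⟩ | ⟨j, -, h⟩) | h)
        · simp at h
        · simp only [Lozenge.negative.injEq, true_and] at h
          rwa [hmono.injective h]
        · simp at h
        · have := hcol D hD t ht _ h
          simp [Lozenge.column] at this
    refine ⟨(Finset.univ.filter V).biUnion fun D =>
      (𝒯 D).image fun t => columnLozenges a b c m y D ∪ t, fun t => ?_, ?_⟩
    · simp only [Finset.mem_biUnion, Finset.mem_filter, Finset.mem_univ, true_and,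
        Finset.mem_image]
      constructor
      · rintro ⟨D, hD, t', ht', rfl⟩
        exact isTiling_rightPart_of_lower hm hmono.injective hy hD.1 hD.2
          (((h𝒯 D hD).1 t').1 ht') fun l => Finset.mem_union
      · intro ht
        obtain ⟨D, hD, t', ht', h⟩ := exists_of_isTiling_rightPart hm hmono.injective hy ht
        exact ⟨D, hD, t', ((h𝒯 D hD).1 t').2 ht', by ext l; rw [h, Finset.mem_union]⟩
    rw [Finset.sum_biUnion]
    swap
    · intro D hD D' hD' hne
      rw [Function.onFun, Finset.disjoint_left]
      intro t ht ht'
      obtain ⟨s, hs, rfl⟩ := Finset.mem_image.1 ht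
      obtain ⟨s', hs', h⟩ := Finset.mem_image.1 ht'
      simp only [Finset.coe_filter, Finset.mem_univ, true_and, Set.mem_ofPred_eq] at hD hD'
      apply hne
      ext i
      rw [hmemD D hD s hs i, ← h, ← hmemD D' hD' s' hs' i]
    have hsum : ∀ D ∈ Finset.univ.filter V,
        (∑ t ∈ (𝒯 D).image fun t => columnLozenges a b c m y D ∪ t,
          ∏ l ∈ t, weightAt (heightWeight q X Y) a k l) *
          (stateWeight q X Y k a b c (b + c) (fun i => (i : ℤ) - c) *
            ∏ i, heightWeight q X Y (iCoord a k m (y i) + 1)) =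
        (∏ z ∈ edges a b c m, heightWeight q X Y (iCoord a k m z + 1)) *
          (stateWeight q X Y k a b c (m + 1) (lower y D) *
            ∏ p ∈ Finset.Ico (m + 1) (b + c),
            ((∏ j ∈ Finset.range a, qIntZ q ((a : ℤ) + b + c - 1 - p - j)) *
              ∏ z ∈ edges a b c p, heightWeight q X Y (iCoord a k p z + 1))) := by
      intro D hD
      replace hD : V D := (Finset.mem_filter.1 hD).2
      rw [Finset.sum_image, ← (h𝒯 D hD).2, ← prod_columnLozenges _ k hmono.injective hy D]
      · rw [Finset.sum_congr rfl fun t ht => Finset.prod_union (hdisj D hD t ht),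
          ← Finset.mul_sum]
        ring
      · intro t ht t' ht' h
        rw [← hfilter D hD t ht, ← hfilter D hD t' ht']
        exact congrArg _ h
    have hall : ∑ D ∈ Finset.univ.filter V, stateWeight q X Y k a b c (m + 1) (lower y D) =
        ∑ D, stateWeight q X Y k a b c (m + 1) (lower y D) := by
      refine Finset.sum_subset (Finset.filter_subset _ _) fun D _ hD => ?_
      have hD' : ¬ V D := by simpa using hD
      by_cases hinj : Function.Injective (lower y D)
      · -- an edge that has left the hexagon contributes a vanishing factor
        have : ∃ i, lower y D i ∉ edges a b c (m + 1) := by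
          by_contra hcon
          exact hD' ⟨hinj, by simpa using hcon⟩
        obtain ⟨i, hi⟩ := this
        have h1 := mem_edges.1 (hy i)
        have h2 : y i - 1 ≤ lower y D i ∧ lower y D i ≤ y i := by
          by_cases hiD : i ∈ D
          · rw [lower_of_mem y hiD]; omega
          · rw [lower_of_notMem y hiD]; omega
        rw [stateWeight, Finset.prod_eq_zero (Finset.mem_univ i), zero_mul]
        exact edgeFactor_eq_zero q X Y k i.pos (by push_cast; omega) (by omega) hi
      · exact stateWeight_eq_zero_of_not_injective q X Y k hinj
    have hprod : ∏ i, heightWeight q X Y (iCoord a k m (y i) + 1) ≠ 0 :=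
      Finset.prod_ne_zero_iff.2 fun i _ => hv _
    apply mul_right_cancel₀ hprod
    rw [mul_assoc, Finset.sum_mul, Finset.sum_congr rfl hsum, ← Finset.mul_sum, ← Finset.sum_mul,
      hall, sum_stateWeight_lower hq0 hq X Y k hy, Finset.prod_eq_prod_Ico_succ_bot hm]
    ring

end Recursion

/-! ### The product formula for generic weights -/

section Products

/-- Two ways to multiply a function of the height over the cells of a rectangle with one corner cut
off: on the left the cells are sorted by the vertical lines of the hexagon, on the right by a
subdivision of the rectangle into smaller ones. -/
theorem prod_grid_comm {R : Type*} [CommRing R] (f : ℤ → R) (k : ℤ) (a b c : ℕ) :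
    (∏ p ∈ Finset.range (b + c), ∏ z ∈ edges a b c p, f (iCoord a k p z + 1)) *
      ∏ i : Fin a, ∏ j ∈ Finset.Ioi i, f (k - a + i + j + 1) =
    (∏ i ∈ Finset.range b, ∏ j ∈ Finset.range c, f (k + i - j)) *
      (∏ i : Fin a, ∏ j ∈ Finset.Ioi i, f (k - a + b - c + i + j + 1)) *
      ((∏ u ∈ Finset.range a, ∏ s ∈ Finset.range b, f (k - a - c + 1 + u + s)) *
        ∏ u ∈ Finset.range a, ∏ t ∈ Finset.range c, f (k + u - t + b)) := by
  classical
  -- the cells `(y, z)` of a rectangle, with the edge from `(x, y)` to `(x, y + 1)` at `z = x + y`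
  set S : Finset (ℤ × ℤ) := (Finset.Icc (-(c : ℤ)) (a - 1) ×ˢ Finset.Icc (0 : ℤ) (a + b - 1)).filter
    fun p => p.2 - p.1 < b + c with hS
  set g : ℤ × ℤ → R := fun p => f (k - a + p.1 + p.2 + 1) with hg
  have hmem : ∀ p : ℤ × ℤ, p ∈ S ↔
      (-(c : ℤ) ≤ p.1 ∧ p.1 + 1 ≤ a) ∧ (0 ≤ p.2 ∧ p.2 + 1 ≤ a + b) ∧ p.2 - p.1 < b + c := by
    intro p
    simp only [hS, Finset.mem_filter, Finset.mem_product, Finset.mem_Icc]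
    omega
  have h1 : ∏ p ∈ Finset.range (b + c), ∏ z ∈ edges a b c p, f (iCoord a k p z + 1) =
      ∏ p ∈ S.filter (fun p => p.1 ≤ p.2), g p := by
    rw [Finset.prod_sigma']
    refine Finset.prod_nbij' (fun x => (x.2, x.1 + x.2)) (fun p => ⟨(p.2 - p.1).toNat, p.1⟩)
      ?_ ?_ ?_ ?_ ?_
    · rintro ⟨p, z⟩ h
      simp only [Finset.mem_sigma, Finset.mem_range, mem_edges] at h
      simp only [Finset.mem_filter, hmem]
      omega
    · rintro ⟨y, z⟩ h
      simp only [Finset.mem_filter, hmem] at h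
      simp only [Finset.mem_sigma, Finset.mem_range, mem_edges]
      omega
    · rintro ⟨p, z⟩ h
      simp
    · rintro ⟨y, z⟩ h
      simp only [Finset.mem_filter, hmem] at h
      ext <;> simp only <;> omega
    · rintro ⟨p, z⟩ h
      simp only [hg, iCoord]
      congr 1
      ring
  have h2 : ∏ i : Fin a, ∏ j ∈ Finset.Ioi i, f (k - a + i + j + 1) =
      ∏ p ∈ S.filter (fun p => ¬ p.1 ≤ p.2), g p := by
    rw [Finset.prod_sigma']
    refine Finset.prod_bij' (fun x _ => ((x.2 : ℤ), (x.1 : ℤ)))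
      (fun p hp => ⟨⟨p.2.toNat, ?_⟩, ⟨p.1.toNat, ?_⟩⟩) ?_ ?_ ?_ ?_ ?_
    · simp only [Finset.mem_filter, hmem] at hp; omega
    · simp only [Finset.mem_filter, hmem] at hp; omega
    · rintro ⟨i, j⟩ h
      simp only [Finset.mem_sigma, Finset.mem_univ, Finset.mem_Ioi, true_and, Fin.lt_def] at h
      simp only [Finset.mem_filter, hmem]
      omega
    · rintro ⟨y, z⟩ h
      simp only [Finset.mem_filter, hmem] at h
      simp only [Finset.mem_sigma, Finset.mem_univ, Finset.mem_Ioi, true_and, Fin.lt_def]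
      omega
    · rintro ⟨i, j⟩ h
      simp
    · rintro ⟨y, z⟩ h
      simp only [Finset.mem_filter, hmem] at h
      ext <;> simp only <;> omega
    · rintro ⟨i, j⟩ h
      simp only [hg]
      congr 1
      ring
  have h3 : ∏ i ∈ Finset.range b, ∏ j ∈ Finset.range c, f (k + i - j) =
      ∏ p ∈ (S.filter fun p => p.2 < (b : ℤ)).filter (fun p => (a : ℤ) ≤ p.1 + c), g p := by
    rw [Finset.prod_sigma']
    refine Finset.prod_nbij' (fun x => ((a : ℤ) - 1 - x.2, (x.1 : ℤ)))
      (fun p => ⟨p.2.toNat, (a - 1 - p.1).toNat⟩) ?_ ?_ ?_ ?_ ?_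
    · rintro ⟨i, j⟩ h
      simp only [Finset.mem_sigma, Finset.mem_range] at h
      simp only [Finset.mem_filter, hmem]
      omega
    · rintro ⟨y, z⟩ h
      simp only [Finset.mem_filter, hmem] at h
      simp only [Finset.mem_sigma, Finset.mem_range]
      omega
    · rintro ⟨i, j⟩ h
      simp
    · rintro ⟨y, z⟩ h
      simp only [Finset.mem_filter, hmem] at h
      ext <;> simp only <;> omega
    · rintro ⟨i, j⟩ h
      simp only [hg]
      congr 1
      ring
  have h4 : ∏ u ∈ Finset.range a, ∏ s ∈ Finset.range b, f (k - a - c + 1 + u + s) =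
      ∏ p ∈ (S.filter fun p => p.2 < (b : ℤ)).filter (fun p => ¬ (a : ℤ) ≤ p.1 + c), g p := by
    rw [Finset.prod_sigma']
    refine Finset.prod_nbij' (fun x => ((x.1 : ℤ) - c, (x.2 : ℤ)))
      (fun p => ⟨(p.1 + c).toNat, p.2.toNat⟩) ?_ ?_ ?_ ?_ ?_
    · rintro ⟨i, j⟩ h
      simp only [Finset.mem_sigma, Finset.mem_range] at h
      simp only [Finset.mem_filter, hmem]
      omega
    · rintro ⟨y, z⟩ h
      simp only [Finset.mem_filter, hmem] at h
      simp only [Finset.mem_sigma, Finset.mem_range]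
      omega
    · rintro ⟨i, j⟩ h
      simp
    · rintro ⟨y, z⟩ h
      simp only [Finset.mem_filter, hmem] at h
      ext <;> simp only <;> omega
    · rintro ⟨i, j⟩ h
      simp only [hg]
      congr 1
      ring
  have h5 : ∏ u ∈ Finset.range a, ∏ t ∈ Finset.range c, f (k + u - t + b) =
      ∏ p ∈ (S.filter fun p => ¬ p.2 < (b : ℤ)).filter (fun p => (a : ℤ) ≤ p.1 + c), g p := by
    rw [Finset.prod_sigma']
    refine Finset.prod_nbij' (fun x => ((a : ℤ) - 1 - x.2, (x.1 : ℤ) + b))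
      (fun p => ⟨(p.2 - b).toNat, (a - 1 - p.1).toNat⟩) ?_ ?_ ?_ ?_ ?_
    · rintro ⟨i, j⟩ h
      simp only [Finset.mem_sigma, Finset.mem_range] at h
      simp only [Finset.mem_filter, hmem]
      omega
    · rintro ⟨y, z⟩ h
      simp only [Finset.mem_filter, hmem] at h
      simp only [Finset.mem_sigma, Finset.mem_range]
      omega
    · rintro ⟨i, j⟩ h
      simp
    · rintro ⟨y, z⟩ h
      simp only [Finset.mem_filter, hmem] at h
      ext <;> simp only <;> omega
    · rintro ⟨i, j⟩ h
      simp only [hg]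
      congr 1
      ring
  have h6 : ∏ i : Fin a, ∏ j ∈ Finset.Ioi i, f (k - a + b - c + i + j + 1) =
      ∏ p ∈ (S.filter fun p => ¬ p.2 < (b : ℤ)).filter (fun p => ¬ (a : ℤ) ≤ p.1 + c), g p := by
    rw [Finset.prod_sigma']
    refine Finset.prod_bij' (fun x _ => ((x.2 : ℤ) - c, (x.1 : ℤ) + b))
      (fun p hp => ⟨⟨(p.2 - b).toNat, ?_⟩, ⟨(p.1 + c).toNat, ?_⟩⟩) ?_ ?_ ?_ ?_ ?_
    · simp only [Finset.mem_filter, hmem] at hp; omega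
    · simp only [Finset.mem_filter, hmem] at hp; omega
    · rintro ⟨i, j⟩ h
      simp only [Finset.mem_sigma, Finset.mem_univ, Finset.mem_Ioi, true_and, Fin.lt_def] at h
      simp only [Finset.mem_filter, hmem]
      omega
    · rintro ⟨y, z⟩ h
      simp only [Finset.mem_filter, hmem] at h
      simp only [Finset.mem_sigma, Finset.mem_univ, Finset.mem_Ioi, true_and, Fin.lt_def]
      omega
    · rintro ⟨i, j⟩ h
      simp
    · rintro ⟨y, z⟩ h
      simp only [Finset.mem_filter, hmem] at h
      ext <;> simp only <;> omega
    · rintro ⟨i, j⟩ h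
      simp only [hg]
      congr 1
      ring
  rw [h1, h2, h3, h4, h5, h6, Finset.prod_filter_mul_prod_filter_not,
    ← Finset.prod_filter_mul_prod_filter_not S (fun p => p.2 < (b : ℤ)),
    ← Finset.prod_filter_mul_prod_filter_not (S.filter fun p => p.2 < (b : ℤ))
      (fun p => (a : ℤ) ≤ p.1 + c),
    ← Finset.prod_filter_mul_prod_filter_not (S.filter fun p => ¬ p.2 < (b : ℤ))
      (fun p => (a : ℤ) ≤ p.1 + c)]
  ring

variable {K : Type*} [Field K]

theorem prod_qIntZ_mul_qSuperfactorial (q : K) (x y : ℕ) :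
    (∏ i ∈ Finset.range x, ∏ j ∈ Finset.range y, qIntZ q (i + j + 1)) *
      (qSuperfactorial q x * qSuperfactorial q y) = qSuperfactorial q (x + y) := by
  have hfac : ∀ x y : ℕ, (∏ j ∈ Finset.range y, qIntZ q (x + j + 1)) * qFactorial q x =
      qFactorial q (x + y) := by
    intro x y
    induction y with
    | zero => simp
    | succ y ih =>
      rw [Finset.prod_range_succ, mul_right_comm, ih, ← add_assoc, qFactorial, qFactorial,
        Finset.prod_Icc_succ_top (by omega)]
      simp [qIntZ, qInt]
  induction x with
  | zero => simp [qSuperfactorial]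
  | succ x ih =>
    have hsucc : ∀ n, qSuperfactorial q (n + 1) = qSuperfactorial q n * qFactorial q n :=
      fun n => Finset.prod_range_succ _ _
    rw [Finset.prod_range_succ, show x + 1 + y = x + y + 1 by ring, hsucc, hsucc, ← hfac x y, ← ih]
    ring

theorem prod_qIntZ_reflect (q : K) (x y : ℕ) :
    ∏ i ∈ Finset.range x, ∏ j ∈ Finset.range y, qIntZ q ((x : ℤ) + y - 1 - i - j) =
      ∏ i ∈ Finset.range x, ∏ j ∈ Finset.range y, qIntZ q (i + j + 1) := by
  rw [← Finset.prod_range_reflect]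
  refine Finset.prod_congr rfl fun i hi => ?_
  rw [← Finset.prod_range_reflect]
  refine Finset.prod_congr rfl fun j hj => ?_
  rw [Finset.mem_range] at hi hj
  congr 1
  omega

theorem qIntZ_ne_zero_of_qSuperfactorial {q : K} {x : ℕ} (h : qSuperfactorial q x ≠ 0) {n : ℤ}
    (h1 : 1 ≤ n) (hn : n < x) : qIntZ q n ≠ 0 := by
  obtain ⟨n, rfl⟩ : ∃ p : ℕ, n = p := ⟨n.toNat, by omega⟩
  have := Finset.prod_ne_zero_iff.1 h n (by simp; omega)
  exact Finset.prod_ne_zero_iff.1 this n (by simp; omega)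

/-- The factors that the `i`-th edge from below acquires on its way from the left to the right side
of the hexagon. -/
theorem edgeFactor_last (q X Y : K) (k : ℤ) (a b c : ℕ) (i : Fin a) :
    edgeFactor q X Y k a b c (b + c) ((i : ℤ) - c) =
      edgeFactor q X Y k a b c 0 i *
        ((∏ s ∈ Finset.range b, riseFactor q X Y k a b c (i + s)) *
          ∏ t ∈ Finset.range c, fallFactor q X Y k a b c (a - 1 - i + t)) := by
  have h1 : (((b + c : ℕ) : ℤ) + ((i : ℤ) - c)).toNat = i + b := by omega
  have h2 : ((a : ℤ) - 1 - ((i : ℤ) - c)).toNat = a - 1 - i + c := by omega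
  have h3 : (((0 : ℕ) : ℤ) + (i : ℤ)).toNat = i := by omega
  have h4 : ((a : ℤ) - 1 - (i : ℤ)).toNat = a - 1 - i := by omega
  rw [edgeFactor, edgeFactor, h1, h2, h3, h4, Finset.prod_range_add, Finset.prod_range_add]
  ring

/-- The Vandermonde determinant of consecutive edges of a vertical line splits into `q`-integers,
which do not depend on the line, and weights of horizontal lozenges. -/
theorem det_vandermonde_spectral_arith {q : K} (hq0 : q ≠ 0) (hq : q ^ 2 ≠ 1) (X Y : K) (t : ℤ)
    {a : ℕ} {n : Fin a → ℤ} (hn : ∀ i, n i = t + 2 * i) :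
    (Matrix.vandermonde fun i => spectral q X Y (n i)).det =
      (∏ i : Fin a, ∏ j ∈ Finset.Ioi i, (q - q⁻¹) * qIntZ q ((j : ℤ) - i)) *
        ∏ i : Fin a, ∏ j ∈ Finset.Ioi i, heightWeight q X Y (t + i + j) := by
  rw [Matrix.det_vandermonde]
  simp only [← Finset.prod_mul_distrib]
  refine Finset.prod_congr rfl fun i _ => Finset.prod_congr rfl fun j _ => ?_
  have := spectral_sub_spectral hq0 hq X Y ((j : ℤ) - i) (t + i + j)
  rw [hn, hn, mul_assoc, ← this]
  congr 2 <;> ring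

theorem rightPart_zero (a b c : ℕ) :
    rightPart a b c 0 (fun i : Fin a => (i : ℤ)) = hexagon a b c := by
  ext T
  rcases T with ⟨x, z⟩ | ⟨x, z⟩
  · rw [right_mem_rightPart, right_mem_hexagon]
    push_cast; omega
  · rw [left_mem_rightPart, left_mem_hexagon, mem_edges]
    push_cast
    constructor
    · rintro (h | ⟨rfl, h, h'⟩)
      · exact h.2
      · exact (h' ⟨⟨z.toNat, by omega⟩, by simp; omega⟩).elim
    · intro h
      exact .inl ⟨by omega, h⟩

/-- The product formula when no height has weight zero. -/
theorem sum_tilings_of_ne_zero {q : K} (hq0 : q ≠ 0) (hq : q ^ 2 ≠ 1) (X Y : K)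
    (hv : ∀ n, heightWeight q X Y n ≠ 0) (k : ℤ) (a b c : ℕ)
    (hab : qSuperfactorial q (a + b) ≠ 0) (hca : qSuperfactorial q (c + a) ≠ 0) :
    (∑ t ∈ (finite_tilings a b c).toFinset, ∏ l ∈ t, weightAt (heightWeight q X Y) a k l) *
      (qSuperfactorial q (a + b) * qSuperfactorial q (b + c) * qSuperfactorial q (c + a)) =
    (∏ i ∈ Finset.range b, ∏ j ∈ Finset.range c, heightWeight q X Y (k + i - j)) *
      (qSuperfactorial q a * qSuperfactorial q b * qSuperfactorial q c *
        qSuperfactorial q (a + b + c)) := by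
  have hd := sub_inv_ne_zero hq0 hq
  obtain ⟨𝒯, h𝒯, hsum⟩ := exists_tilings_rightPart hq0 hq X Y hv k a b c (b + c) 0 (by simp)
    (fun i : Fin a => (i : ℤ)) (fun i j hij => by simpa using hij)
    (fun i => by rw [mem_edges]; push_cast; omega)
  obtain rfl : 𝒯 = (finite_tilings a b c).toFinset := by
    ext t
    rw [h𝒯, rightPart_zero, Set.Finite.mem_toFinset]
    rfl
  set Z := ∑ t ∈ (finite_tilings a b c).toFinset, ∏ l ∈ t, weightAt (heightWeight q X Y) a k l
  have hlast : ∏ i : Fin a, edgeFactor q X Y k a b c (b + c) ((i : ℤ) - c) =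
      (∏ i : Fin a, edgeFactor q X Y k a b c 0 i) *
      (((∏ i ∈ Finset.range a, ∏ j ∈ Finset.range b, qIntZ q (i + j + 1)) *
        ∏ i ∈ Finset.range a, ∏ j ∈ Finset.range c, qIntZ q (i + j + 1)) *
      ((∏ u ∈ Finset.range a, ∏ s ∈ Finset.range b, heightWeight q X Y (k - a - c + 1 + u + s)) *
        ∏ u ∈ Finset.range a, ∏ t ∈ Finset.range c, heightWeight q X Y (k + u - t + b))) := by
    have hrise : ∏ i : Fin a, ∏ s ∈ Finset.range b, riseFactor q X Y k a b c (i + s) =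
        (∏ i ∈ Finset.range a, ∏ j ∈ Finset.range b, qIntZ q (i + j + 1)) *
        ∏ u ∈ Finset.range a, ∏ s ∈ Finset.range b,
          heightWeight q X Y (k - a - c + 1 + u + s) := by
      rw [Fin.prod_univ_eq_prod_range
        (fun i => ∏ s ∈ Finset.range b, riseFactor q X Y k a b c (i + s)),
        ← prod_qIntZ_reflect]
      simp only [← Finset.prod_mul_distrib]
      refine Finset.prod_congr rfl fun i _ => Finset.prod_congr rfl fun j _ => ?_
      rw [riseFactor]
      congr 2 <;> push_cast <;> ring
    have hfall : ∏ i : Fin a, ∏ t ∈ Finset.range c, fallFactor q X Y k a b c (a - 1 - i + t) =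
        (∏ i ∈ Finset.range a, ∏ j ∈ Finset.range c, qIntZ q (i + j + 1)) *
        ∏ u ∈ Finset.range a, ∏ t ∈ Finset.range c, heightWeight q X Y (k + u - t + b) := by
      rw [Fin.prod_univ_eq_prod_range
        (fun i => ∏ t ∈ Finset.range c, fallFactor q X Y k a b c (a - 1 - i + t))]
      simp only [← Finset.prod_mul_distrib]
      refine Finset.prod_congr rfl fun i hi => ?_
      rw [Finset.mem_range] at hi
      rw [Finset.prod_mul_distrib, ← Finset.prod_range_reflect (fun j => qIntZ q (i + j + 1)),
        ← Finset.prod_mul_distrib]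
      refine Finset.prod_congr rfl fun j hj => ?_
      rw [Finset.mem_range] at hj
      rw [fallFactor]
      congr 2 <;> omega
    simp only [edgeFactor_last, Finset.prod_mul_distrib]
    rw [hrise, hfall]
    ring
  have hK : ∏ p ∈ Finset.range (b + c), ∏ j ∈ Finset.range a,
      qIntZ q ((a : ℤ) + b + c - 1 - p - j) =
      ∏ i ∈ Finset.range (b + c), ∏ j ∈ Finset.range a, qIntZ q (i + j + 1) := by
    rw [← prod_qIntZ_reflect]
    refine Finset.prod_congr rfl fun i _ => Finset.prod_congr rfl fun j _ => ?_
    congr 1; push_cast; ring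
  rw [stateWeight, stateWeight, hlast,
    det_vandermonde_spectral_arith hq0 hq X Y (k - a + b - c + 1)
      (fun i => by rw [iCoord]; push_cast; ring),
    det_vandermonde_spectral_arith hq0 hq X Y (k - a + 1)
      (fun i => by rw [iCoord]; push_cast; ring), ← Finset.range_eq_Ico, Finset.prod_mul_distrib,
    hK] at hsum
  -- the Vandermonde determinants share their `q`-integers, and `prod_grid_comm` balances the weights
  have hgrid := prod_grid_comm (heightWeight q X Y) k a b c
  have e1 : ∀ i j : ℤ, k - a + i + j + 1 = k - a + 1 + i + j := fun i j => by ring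
  have e2 : ∀ i j : ℤ, k - a + b - c + i + j + 1 = k - a + b - c + 1 + i + j :=
    fun i j => by ring
  simp only [e1, e2] at hgrid
  have hF : ∏ i : Fin a, edgeFactor q X Y k a b c 0 i ≠ 0 := by
    refine Finset.prod_ne_zero_iff.2 fun i _ => mul_ne_zero ?_ ?_
    · refine Finset.prod_ne_zero_iff.2 fun s hs => mul_ne_zero ?_ (hv _)
      rw [Finset.mem_range] at hs
      exact qIntZ_ne_zero_of_qSuperfactorial hab (by omega) (by push_cast; omega)
    · refine Finset.prod_ne_zero_iff.2 fun s hs => mul_ne_zero ?_ (hv _)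
      rw [Finset.mem_range] at hs
      exact qIntZ_ne_zero_of_qSuperfactorial hca (by omega) (by push_cast; omega)
  have hQ : ∏ i : Fin a, ∏ j ∈ Finset.Ioi i, (q - q⁻¹) * qIntZ q ((j : ℤ) - i) ≠ 0 := by
    refine Finset.prod_ne_zero_iff.2 fun i _ => Finset.prod_ne_zero_iff.2 fun j hj =>
      mul_ne_zero hd ?_
    rw [Finset.mem_Ioi, Fin.lt_def] at hj
    exact qIntZ_ne_zero_of_qSuperfactorial hab (by omega) (by push_cast; omega)
  have hne : ∀ (s : Finset ℕ) (r : ℕ) (F : ℕ → ℕ → ℤ),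
      ∏ i ∈ s, ∏ j ∈ Finset.range r, heightWeight q X Y (F i j) ≠ 0 := fun s r F =>
    Finset.prod_ne_zero_iff.2 fun i _ => Finset.prod_ne_zero_iff.2 fun j _ => hv _
  have hD : ∏ i : Fin a, ∏ j ∈ Finset.Ioi i,
      heightWeight q X Y (k - a + b - c + 1 + i + j) ≠ 0 :=
    Finset.prod_ne_zero_iff.2 fun i _ => Finset.prod_ne_zero_iff.2 fun j _ => hv _
  have hR := hne (Finset.range a) b fun u s => k - a - c + 1 + u + s
  have hL := hne (Finset.range a) c fun u t => k + u - t + b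
  have sab := prod_qIntZ_mul_qSuperfactorial q a b
  have sac := prod_qIntZ_mul_qSuperfactorial q a c
  have sabc := prod_qIntZ_mul_qSuperfactorial q (b + c) a
  rw [show b + c + a = a + b + c by ring] at sabc
  rw [show c + a = a + c by ring, ← sab, ← sac, ← sabc]
  generalize (∏ i : Fin a, edgeFactor q X Y k a b c 0 i) = F at *
  generalize (∏ i : Fin a, ∏ j ∈ Finset.Ioi i, (q - q⁻¹) * qIntZ q ((j : ℤ) - i)) = Q at *
  generalize (∏ i : Fin a, ∏ j ∈ Finset.Ioi i,
    heightWeight q X Y (k - a + b - c + 1 + i + j)) = De at *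
  generalize (∏ i : Fin a, ∏ j ∈ Finset.Ioi i,
    heightWeight q X Y (k - a + 1 + i + j)) = D0 at *
  generalize (∏ u ∈ Finset.range a, ∏ s ∈ Finset.range b,
    heightWeight q X Y (k - a - c + 1 + u + s)) = VR at *
  generalize (∏ u ∈ Finset.range a, ∏ t ∈ Finset.range c,
    heightWeight q X Y (k + u - t + b)) = VL at *
  generalize (∏ i ∈ Finset.range b, ∏ j ∈ Finset.range c,
    heightWeight q X Y (k + i - j)) = VB at *
  generalize (∏ p ∈ Finset.range (b + c), ∏ z ∈ edges a b c p,
    heightWeight q X Y (iCoord a k p z + 1)) = VV at *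
  generalize (∏ i ∈ Finset.range a, ∏ j ∈ Finset.range b, qIntZ q (i + j + 1)) = Pab at *
  generalize (∏ i ∈ Finset.range a, ∏ j ∈ Finset.range c, qIntZ q (i + j + 1)) = Pac at *
  generalize (∏ i ∈ Finset.range (b + c), ∏ j ∈ Finset.range a, qIntZ q (i + j + 1)) = Pabc at *
  have hmain : Z * (Pab * Pac) = VB * Pabc := by
    apply mul_right_cancel₀ (mul_ne_zero (mul_ne_zero (mul_ne_zero hF hQ) hD)
      (mul_ne_zero hR hL))
    linear_combination hsum + F * Q * Pabc * hgrid
  linear_combination (qSuperfactorial q a * qSuperfactorial q b * qSuperfactorial q (b + c) *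
    (qSuperfactorial q a * qSuperfactorial q c)) * hmain

end Products

/-! ### Specialization -/

section Descent

theorem map_weightAt {R S : Type*} [CommRing R] [CommRing S] (φ : R →+* S) (w : ℤ → R) (a : ℕ)
    (k : ℤ) (l : Lozenge) : φ (weightAt w a k l) = weightAt (fun n => φ (w n)) a k l := by
  cases l <;> simp [weightAt]

theorem map_qSuperfactorial {K L : Type*} [Field K] [Field L] (φ : K →+* L) (q : K) (n : ℕ) :
    φ (qSuperfactorial q n) = qSuperfactorial (φ q) n := by
  simp [qSuperfactorial, qFactorial, qInt]

open Polynomial in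
/-- The product formula, cleared of denominators. It follows from its analogue over the field of
fractions of `K[T]` with `X + T` in place of `X`, where no height has weight zero, on putting
`T = 0`. -/
theorem sum_tilings {K : Type*} [Field K] {q : K} (hq0 : q ≠ 0) (hq : q ^ 2 ≠ 1) (X Y : K)
    (k : ℤ) (a b c : ℕ) (hab : qSuperfactorial q (a + b) ≠ 0)
    (hca : qSuperfactorial q (c + a) ≠ 0) :
    (∑ t ∈ (finite_tilings a b c).toFinset, ∏ l ∈ t, weightAt (heightWeight q X Y) a k l) *
      (qSuperfactorial q (a + b) * qSuperfactorial q (b + c) * qSuperfactorial q (c + a)) =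
    (∏ i ∈ Finset.range b, ∏ j ∈ Finset.range c, heightWeight q X Y (k + i - j)) *
      (qSuperfactorial q a * qSuperfactorial q b * qSuperfactorial q c *
        qSuperfactorial q (a + b + c)) := by
  let ι : K[X] →+* FractionRing K[X] := algebraMap _ _
  have hι : Function.Injective ι := IsFractionRing.injective _ _
  let φ : K →+* FractionRing K[X] := ι.comp C
  set w : ℤ → K[X] := fun n => C (heightWeight q X Y n) + C (q ^ n) * Polynomial.X with hw
  have hφw : ∀ n, heightWeight (φ q) (ι (C X + Polynomial.X)) (φ Y) n = ι (w n) := by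
    intro n
    simp only [heightWeight, hw, ← map_zpow₀]
    simp only [φ, RingHom.comp_apply, ← map_mul, ← map_add]
    congr 1
    simp only [map_add, map_mul]
    ring
  have hw0 : ∀ n, w n ≠ 0 := by
    intro n h
    have := congrArg (fun p => coeff p 1) h
    simp [hw, coeff_C, zpow_ne_zero _ hq0] at this
  have h := sum_tilings_of_ne_zero (q := φ q) (by simpa using hq0)
    (fun h => hq (φ.injective (by rw [map_pow, map_one]; exact h))) (ι (C X + Polynomial.X)) (φ Y)
    (fun n => by rw [hφw]; exact (map_ne_zero_iff ι hι).2 (hw0 n)) k a b c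
    (by rw [← map_qSuperfactorial]; simpa using hab)
    (by rw [← map_qSuperfactorial]; simpa using hca)
  have hfun : heightWeight (φ q) (ι (C X + Polynomial.X)) (φ Y) = fun n => ι (w n) := funext hφw
  simp only [hfun, ← map_weightAt, ← map_qSuperfactorial] at h
  simp only [φ, RingHom.comp_apply, ← map_mul, ← map_prod, ← map_sum] at h
  have h0 := congrArg (evalRingHom (0 : K)) (hι h)
  have hwe : (fun n => evalRingHom (0 : K) (w n)) = heightWeight q X Y := by
    ext n; simp [hw]
  have hwe' : ∀ n, evalRingHom (0 : K) (w n) = heightWeight q X Y n := congrFun hwe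
  have hC : ∀ x, evalRingHom (0 : K) (C x) = x := fun x => by simp
  simpa only [map_mul, map_sum, map_prod, map_weightAt, hwe, hwe', hC] using h0

theorem lozengeWeight_eq {K : Type*} [Field K] (q X Y : K) (a : ℕ) (k : ℤ) :
    lozengeWeight q X Y a k = weightAt (heightWeight q (X / 2) (Y / 2)) a k := by
  ext l
  cases l <;> simp only [lozengeWeight, weightAt, heightWeight]
  ring

end Descent
end LozengeTiling

theorem corollaryA3 {K : Type*} [Field K] (h2 : (2 : K) ≠ 0) (q X Y : K) (hq0 : q ≠ 0)
    (hq : q ^ 2 ≠ 1) (k : ℤ) (a b c : ℕ)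
    (hden : LozengeTiling.qSuperfactorial q (a + b) * LozengeTiling.qSuperfactorial q (b + c) *
      LozengeTiling.qSuperfactorial q (c + a) ≠ 0) :
    LozengeTiling.tilingGF q X Y k a b c =
      (∏ i ∈ Finset.Icc 1 b, ∏ j ∈ Finset.Icc 1 c,
        (X * q ^ (k + (i : ℤ) - (j : ℤ)) + Y * q ^ (-(k + (i : ℤ) - (j : ℤ)))) / 2) *
      (LozengeTiling.qSuperfactorial q a * LozengeTiling.qSuperfactorial q b *
          LozengeTiling.qSuperfactorial q c * LozengeTiling.qSuperfactorial q (a + b + c) /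
        (LozengeTiling.qSuperfactorial q (a + b) * LozengeTiling.qSuperfactorial q (b + c) *
          LozengeTiling.qSuperfactorial q (c + a))) := by
  have hab := left_ne_zero_of_mul (left_ne_zero_of_mul hden)
  have hca := right_ne_zero_of_mul hden
  have h := LozengeTiling.sum_tilings hq0 hq (X / 2) (Y / 2) k a b c hab hca
  have hIcc : ∀ (n : ℕ) (f : ℕ → K), ∏ i ∈ Finset.Icc 1 n, f i =
      ∏ i ∈ Finset.range n, f (i + 1) := by
    intro n f
    rw [Finset.range_eq_Ico, Finset.prod_Ico_add' f 0 n 1, zero_add]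
    rfl
  rw [← mul_div_assoc, eq_div_iff hden, LozengeTiling.tilingGF, LozengeTiling.lozengeWeight_eq, h]
  congr 1
  rw [hIcc]
  refine Finset.prod_congr rfl fun i _ => ?_
  rw [hIcc]
  refine Finset.prod_congr rfl fun j _ => ?_
  rw [LozengeTiling.heightWeight,
    show k + ((i + 1 : ℕ) : ℤ) - ((j + 1 : ℕ) : ℤ) = k + i - j by push_cast; ring]
  ring
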